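/- Let $(\Omega,\mathcal F,(\mathcal F_t)_{t\ge 0},\mathbb P)$ be a filtered probability space satisfying the usual conditions, let $H$ be a separable Hilbert space, and let $X$ be a real-valued square-integrable Lévy process with respect to $(\mathcal F_t)$. Then $X$ has a decomposition $X_t = M_t + bt$ with $M$ a square-integrable Lévy martingale and $b\in\mathbb R$; fix such a decomposition. For $T\in\mathbb R_+$ let $C_{\rm ad}[0,T]$ be the space of adapted curves in $C([0,T];L^2(\Omega;H))$, let $L^2(\mathcal P_T) := L^2(\Omega\times[0,T],\mathcal P_T,\mathbb P\otimes\lambda;H)$, where $\mathcal P_T$ is the predictable $\sigma$-algebra and $\lambda$ is Lebesgue measure, and let $\Phi\in C_{\rm ad}[0,T]$. For an integrator $A$, namely $A=M$ or $A_t=\lambda_t:=t$, let $Y_t = \text{(G-)}(\Phi\cdot A)_t$ be the unique element of $L^2(\Omega;H)$ such that for every $\varepsilon>0$ there is $\delta>0$ with $$\mathbb E\Big[\Big\|Y_t-\sum_{i=0}^{n-1}\Phi_{t_i}(A_{t_{i+1}}-A_{t_i})\Big\|^2\Big]<\varepsilon$$ for every partition $0=t_0<t_1<\dots<t_n=t$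 with $\sup_i|t_{i+1}-t_i|<\delta$. Then for both integrators and all $t\in[0,T]$ such an element exists and is unique. Set $\text{(G-)}(\Phi\cdot X):=\text{(G-)}(\Phi\cdot M)+b\,\text{(G-)}(\Phi\cdot\lambda)$. Then $\text{(G-)}(\Phi\cdot X)\in C_{\rm ad}[0,T]$; there is a predictable version ${}^p\Phi$ of $\Phi$; every predictable version ${}^p\Phi$ of $\Phi$ belongs to $L^2(\mathcal P_T)$, and its Itô integral ${}^p\Phi\cdot X={}^p\Phi\cdot M+b\,({}^p\Phi\cdot\lambda)$ exists, where ${}^p\Phi\cdot M$ is the càdlàg Itô integral against the square-integrable martingale $M$ and ${}^p\Phi\cdot\lambda$ is the pathwise Bochner integral; and $$\text{(G-)}(\Phi\cdot X)={}^p\Phi\cdot X\quad\text{in } C_{\rm ad}[0,T],$$ that is, $\text{(G-)}(\Phi\cdot X)_t=({}^p\Phi\cdot X)_t$ almost surely for every $t\in[0,T]$. In particular, $\text{(G-)}(\Phi\cdot X)$ has a càdlàg version. -/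

import Mathlib

open MeasureTheory ProbabilityTheory Filter Topology
open scoped NNReal ENNReal

namespace LevyCurve

/-- The usual conditions: the filtration is right-continuous and `𝓕 0` contains every
`P`-null set (`P s = 0` refers to the outer measure, so subsets of null sets are included). -/
structure UsualConditions {Ω : Type*} {mΩ : MeasurableSpace Ω} (𝓕 : Filtration ℝ≥0 mΩ)
    (P : Measure Ω) : Prop where
  rightContinuous : 𝓕.IsRightContinuous
  complete : ∀ s : Set Ω, P s = 0 → MeasurableSet[𝓕 0] s

/-- A path is càdlàg: right-continuous with left limits at every time. At an endpoint of the
time set the corresponding one-sided condition is void. -/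
def IsCadlag {ι E : Type*} [TopologicalSpace ι] [Preorder ι] [TopologicalSpace E]
    (f : ι → E) : Prop :=
  ∀ t : ι, ContinuousWithinAt f (Set.Ioi t) t ∧ ∃ l : E, Tendsto f (𝓝[<] t) (𝓝 l)

/-- The Lebesgue measure on the time axis `[0,∞)`. -/
noncomputable def lebesgue : Measure ℝ≥0 := Measure.comap ((↑) : ℝ≥0 → ℝ) volume

/-- Real-valued square-integrable Lévy processes with respect to the filtration `𝓕`. -/
structure IsSquareIntegrableLevy {Ω : Type*} {mΩ : MeasurableSpace Ω} (𝓕 : Filtration ℝ≥0 mΩ)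
    (P : Measure Ω) (X : ℝ≥0 → Ω → ℝ) : Prop where
  adapted : StronglyAdapted 𝓕 X
  zero : ∀ᵐ ω ∂P, X 0 ω = 0
  indep : ∀ s t : ℝ≥0, s ≤ t →
    Indep (MeasurableSpace.comap (fun ω => X t ω - X s ω) inferInstance) (𝓕 s) P
  stationary : ∀ s h : ℝ≥0, IdentDistrib (fun ω => X (s + h) ω - X s ω) (X h) P P
  cadlag : ∀ᵐ ω ∂P, IsCadlag (fun t => X t ω)
  memLp : ∀ t : ℝ≥0, MemLp (X t) 2 P

/-- The semimartingale decomposition `X_t = M_t + b t` of a Lévy process, `M` being a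
square-integrable Lévy martingale and `b` a real number. -/
structure IsLevyDecomposition {Ω : Type*} {mΩ : MeasurableSpace Ω} (𝓕 : Filtration ℝ≥0 mΩ)
    (P : Measure Ω) (X M : ℝ≥0 → Ω → ℝ) (b : ℝ) : Prop where
  levy : IsSquareIntegrableLevy 𝓕 P M
  martingale : Martingale M 𝓕 P
  decomp : ∀ (t : ℝ≥0) (ω : Ω), X t ω = M t ω + b * (t : ℝ)

section

variable {Ω : Type*} {mΩ : MeasurableSpace Ω} (𝓕 : Filtration ℝ≥0 mΩ) (P : Measure Ω)
  [IsProbabilityMeasure P]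
  (H : Type*) [NormedAddCommGroup H] [InnerProductSpace ℝ H] [CompleteSpace H]

/-- `C_ad[0,T]`: the continuous curves `[0,T] → L²(Ω;H)` whose value at time `t` is (the class of)
an `𝓕 t`-measurable random variable; a subspace of the Banach space `C([0,T]; L²(Ω;H))` with the
supremum norm. -/
def Cad (T : ℝ≥0) : Submodule ℝ C(Set.Icc (0 : ℝ≥0) T, Lp H 2 P) where
  carrier := {Φ | ∀ t : Set.Icc (0 : ℝ≥0) T, Φ t ∈ lpMeas H ℝ (𝓕 (t : ℝ≥0)) 2 P}
  add_mem' h₁ h₂ t := Submodule.add_mem _ (h₁ t) (h₂ t)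
  zero_mem' _ := Submodule.zero_mem _
  smul_mem' c _ h t := Submodule.smul_mem _ c (h t)

end

section

variable {Ω : Type*} {mΩ : MeasurableSpace Ω} {𝓕 : Filtration ℝ≥0 mΩ} {P : Measure Ω}
  [IsProbabilityMeasure P]
  {H : Type*} [NormedAddCommGroup H] [InnerProductSpace ℝ H] [CompleteSpace H] {T : ℝ≥0}

/-- The sum `∑ Φ_{t_i} (A_{t_{i+1}} - A_{t_i})` along the times `τ`, for a real integrator `A`. -/
noncomputable def leftSum (A : ℝ≥0 → Ω → ℝ) (Φ : Cad 𝓕 P H T) {n : ℕ}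
    (τ : Fin (n + 1) → Set.Icc (0 : ℝ≥0) T) (ω : Ω) : H :=
  ∑ i : Fin n, (A (τ i.succ) ω - A (τ i.castSucc) ω) • (Φ.1 (τ i.castSucc) : Ω → H) ω

/-- `Y` is the mean-square limit of the sums `leftSum A Φ τ` along the partitions
`0 = τ 0 < ⋯ < τ n = t` of `[0,t]` as their mesh tends to `0`. -/
def IsGIntegralAt (A : ℝ≥0 → Ω → ℝ) (Φ : Cad 𝓕 P H T) (t : Set.Icc (0 : ℝ≥0) T)
    (Y : Lp H 2 P) : Prop :=
  ∀ ε : ℝ, 0 < ε → ∃ δ : ℝ, 0 < δ ∧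
    ∀ (n : ℕ) (τ : Fin (n + 1) → Set.Icc (0 : ℝ≥0) T), StrictMono τ →
      (τ 0 : ℝ≥0) = 0 → τ (Fin.last n) = t →
      (∀ i : Fin n, ((τ i.succ : ℝ≥0) : ℝ) - ((τ i.castSucc : ℝ≥0) : ℝ) < δ) →
      ∫⁻ ω, ‖(Y : Ω → H) ω - leftSum A Φ τ ω‖ₑ ^ 2 ∂P < ENNReal.ofReal ε

/-- The value at time `t` of the (G-) integral `(G-)(Φ · A)`. -/
noncomputable def gIntegral (A : ℝ≥0 → Ω → ℝ) (Φ : Cad 𝓕 P H T) (t : Set.Icc (0 : ℝ≥0) T) :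
    Lp H 2 P :=
  Classical.epsilon (IsGIntegralAt A Φ t)

/-- The Lebesgue measure on the time axis as an integrator. -/
def timeIntegrator : ℝ≥0 → Ω → ℝ := fun t _ => (t : ℝ)

/-- `(G-)(Φ · X) = (G-)(Φ · M) + b (G-)(Φ · λ)` for `X_t = M_t + b t`. -/
noncomputable def gIntegralLevy (M : ℝ≥0 → Ω → ℝ) (b : ℝ) (Φ : Cad 𝓕 P H T)
    (t : Set.Icc (0 : ℝ≥0) T) : Lp H 2 P :=
  gIntegral M Φ t + b • gIntegral timeIntegrator Φ t

/-- `Ψ` is a predictable version of `Φ`. Predictability is that on `[0,∞) × Ω`, whose trace on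
`[0,T] × Ω` is the predictable σ-algebra there; the values of `Ψ` after `T` are irrelevant. -/
structure IsPredictableVersion (Φ : Cad 𝓕 P H T) (Ψ : ℝ≥0 → Ω → H) : Prop where
  predictable : IsStronglyPredictable 𝓕 Ψ
  version : ∀ t : Set.Icc (0 : ℝ≥0) T, Ψ t =ᵐ[P] (Φ.1 t : Ω → H)

end

/-- Elementary predictable processes `∑ ψ_i 1_{(s_i, s_{i+1}]}` with bounded
`𝓕 s_i`-measurable `ψ_i`. (A further summand at time `0` would not affect integrals.) -/
structure ElementaryProcess {Ω : Type*} {mΩ : MeasurableSpace Ω} (𝓕 : Filtration ℝ≥0 mΩ)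
    (H : Type*) [NormedAddCommGroup H] where
  n : ℕ
  time : Fin (n + 1) → ℝ≥0
  mono : Monotone time
  val : Fin n → Ω → H
  measurable : ∀ i : Fin n, StronglyMeasurable[𝓕 (time i.castSucc)] (val i)
  bounded : ∀ i : Fin n, ∃ C : ℝ, ∀ ω : Ω, ‖val i ω‖ ≤ C

section

variable {Ω : Type*} {mΩ : MeasurableSpace Ω} {𝓕 : Filtration ℝ≥0 mΩ}
  {H : Type*} [NormedAddCommGroup H] [InnerProductSpace ℝ H]

/-- The elementary process as a function of time and chance. -/
noncomputable def ElementaryProcess.eval (Ψ : ElementaryProcess 𝓕 H) (s : ℝ≥0) (ω : Ω) : H :=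
  ∑ i : Fin Ψ.n,
    (Set.Ioc (Ψ.time i.castSucc) (Ψ.time i.succ)).indicator (fun _ => Ψ.val i ω) s

/-- The elementary stochastic integral
`(Ψ · M)_t = ∑ ψ_i (M_{s_{i+1} ∧ t} - M_{s_i ∧ t})`. -/
noncomputable def ElementaryProcess.integral (Ψ : ElementaryProcess 𝓕 H) (M : ℝ≥0 → Ω → ℝ)
    (t : ℝ≥0) (ω : Ω) : H :=
  ∑ i : Fin Ψ.n,
    (M (min (Ψ.time i.succ) t) ω - M (min (Ψ.time i.castSucc) t) ω) • Ψ.val i ω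

end

section

variable {Ω : Type*} {mΩ : MeasurableSpace Ω} (𝓕 : Filtration ℝ≥0 mΩ) (P : Measure Ω)
  {H : Type*} [NormedAddCommGroup H] [InnerProductSpace ℝ H] {T : ℝ≥0}

/-- `Φ ∈ L²(𝒫_T)`: the process is predictable and square-integrable with respect to the product
of the Lebesgue measure on `[0,T]` and `P`. -/
structure IsL2Predictable (T : ℝ≥0) (Φ : ℝ≥0 → Ω → H) : Prop where
  predictable : IsStronglyPredictable 𝓕 Φ
  memLp : MemLp (Function.uncurry Φ) 2 ((lebesgue.restrict (Set.Icc (0 : ℝ≥0) T)).prod P)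

/-- `N` is (a càdlàg representative of) the Itô integral process `Φ · M` on `[0,T]` of
`Φ ∈ L²(𝒫_T)` against the square-integrable Lévy martingale `M`: the càdlàg adapted process which
is the mean-square limit of the elementary integrals of elementary processes approximating `Φ` in
`L²(𝒫_T)`. -/
structure IsItoIntegral (M : ℝ≥0 → Ω → ℝ) (Φ : ℝ≥0 → Ω → H)
    (N : Set.Icc (0 : ℝ≥0) T → Ω → H) : Prop where
  integrand : IsL2Predictable 𝓕 P T Φ
  adapted : ∀ t : Set.Icc (0 : ℝ≥0) T, StronglyMeasurable[𝓕 (t : ℝ≥0)] (N t)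
  cadlag : ∀ ω : Ω, IsCadlag (fun t => N t ω)
  limit : ∃ Ψ : ℕ → ElementaryProcess 𝓕 H,
    Tendsto (fun k => eLpNorm (fun p : ℝ≥0 × Ω => (Ψ k).eval p.1 p.2 - Φ p.1 p.2) 2
      ((lebesgue.restrict (Set.Icc (0 : ℝ≥0) T)).prod P)) atTop (𝓝 0) ∧
    ∀ t : Set.Icc (0 : ℝ≥0) T,
      Tendsto (fun k => eLpNorm (fun ω => (Ψ k).integral M t ω - N t ω) 2 P) atTop (𝓝 0)

/-- `Z` is (a càdlàg representative of) the Itô integral process `Φ · X = Φ · M + b (Φ · λ)` on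
`[0,T]` against `X_t = M_t + b t`, where `Φ · λ` is the pathwise Bochner integral. -/
structure IsItoIntegralLevy (M : ℝ≥0 → Ω → ℝ) (b : ℝ) (Φ : ℝ≥0 → Ω → H)
    (Z : Set.Icc (0 : ℝ≥0) T → Ω → H) : Prop where
  adapted : ∀ t : Set.Icc (0 : ℝ≥0) T, StronglyMeasurable[𝓕 (t : ℝ≥0)] (Z t)
  cadlag : ∀ ω : Ω, IsCadlag (fun t => Z t ω)
  pathIntegrable : ∀ᵐ ω ∂P, IntegrableOn (fun s : ℝ≥0 => Φ s ω) (Set.Icc 0 T) lebesgue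
  eq_add : ∃ N : Set.Icc (0 : ℝ≥0) T → Ω → H, IsItoIntegral 𝓕 P M Φ N ∧
    ∀ᵐ ω ∂P, ∀ t : Set.Icc (0 : ℝ≥0) T,
      Z t ω = N t ω + b • ∫ s in Set.Icc (0 : ℝ≥0) (t : ℝ≥0), Φ s ω ∂lebesgue

end

end LevyCurve

/-! Both integrals are identified with one object: the continuous extension of the integral from
step processes to square-integrable integrands. Step processes are finite combinations of atoms `ψ
1_{(s,u]}` with `ψ` square-integrable and `𝓕 s`-measurable. For each of the two integrators `A`
there is a constant `C` such that the mean-square norm of the integral over `[0,t]` is at most `C`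
times the L² norm of the integrand on `[0,t] × Ω` (`IsL2Integrator`). For `M` this is the Itô
isometry with `C² = Var[M 1]`, a consequence of independent centred increments; for time it is
Cauchy–Schwarz with `C² = T`. The bound extends the integral to every limit of step processes
(`ExtendsStepIntegral`).

A curve on the compact interval `[0,T]` is uniformly continuous, so its left-point step processes
along fine partitions are uniformly close in mean square to any predictable version. The sums
defining the (G-) integral are the integrals of exactly these step processes, hence converge to the
extension (`ExtendsStepIntegral.isGIntegralAt`). The Itô integral is a limit of integrals of
elementary processes approximating the same integrand, hence has the same value
(`IsItoIntegral.ae_eq`). For time, the extension is the pathwise Bochner integral. Continuity and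
adaptedness of the curve pass from step processes to the limit, because the error bound is uniform
in `t`.

A predictable version is an almost sure limit, at each fixed time, of left-point step processes with
geometrically small errors. A càdlàg version of the martingale part comes from Doob's maximal
inequality and Borel–Cantelli. The decomposition of `X` subtracts the mean, which is linear in time.
-/

set_option linter.unusedSectionVars false

namespace LevyCurve

/-! ### Lebesgue measure on the time axis -/

section Lebesgue

theorem lebesgue_apply (s : Set ℝ≥0) : lebesgue s = volume (((↑) : ℝ≥0 → ℝ) '' s) :=
  (MeasurableEmbedding.subtype_coe measurableSet_Ici).comap_apply volume s

theorem lebesgue_Ioc (a b : ℝ≥0) : lebesgue (Set.Ioc a b) = ENNReal.ofReal ((b : ℝ) - a) := by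
  rw [lebesgue_apply, ← Real.volume_Ioc]
  congr 1
  ext x
  simp only [Set.mem_image, Set.mem_Ioc]
  constructor
  · rintro ⟨y, ⟨h1, h2⟩, rfl⟩
    exact ⟨mod_cast h1, mod_cast h2⟩
  · rintro ⟨h1, h2⟩
    exact ⟨⟨x, a.2.trans h1.le⟩, ⟨h1, h2⟩, rfl⟩

theorem lebesgue_Icc (a b : ℝ≥0) : lebesgue (Set.Icc a b) = ENNReal.ofReal ((b : ℝ) - a) := by
  rw [lebesgue_apply, ← Real.volume_Icc]
  congr 1
  ext x
  simp only [Set.mem_image, Set.mem_Icc]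
  constructor
  · rintro ⟨y, ⟨h1, h2⟩, rfl⟩
    exact ⟨mod_cast h1, mod_cast h2⟩
  · rintro ⟨h1, h2⟩
    exact ⟨⟨x, a.2.trans h1⟩, ⟨h1, h2⟩, rfl⟩

theorem lebesgue_singleton (a : ℝ≥0) : lebesgue {a} = 0 := by
  rw [lebesgue_apply, Set.image_singleton, Real.volume_singleton]

/-- The Lebesgue measure on `[0,t]`. -/
noncomputable abbrev lebesgueTo (t : ℝ≥0) : Measure ℝ≥0 :=
  lebesgue.restrict (Set.Icc (0 : ℝ≥0) t)

theorem lebesgueTo_univ (t : ℝ≥0) : lebesgueTo t Set.univ = t := by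
  rw [Measure.restrict_apply_univ, lebesgue_Icc, NNReal.coe_zero, sub_zero, ENNReal.ofReal_coe_nnreal]

instance (t : ℝ≥0) : IsFiniteMeasure (lebesgueTo t) :=
  ⟨by rw [lebesgueTo_univ]; exact ENNReal.coe_lt_top⟩

theorem lebesgueTo_mono {s t : ℝ≥0} (h : s ≤ t) : lebesgueTo s ≤ lebesgueTo t :=
  Measure.restrict_mono (Set.Icc_subset_Icc_right h) le_rfl

theorem ae_lebesgueTo_ne (t a : ℝ≥0) : ∀ᵐ s ∂lebesgueTo t, s ≠ a := by
  refine ae_restrict_of_ae ?_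
  rw [ae_iff]
  simpa using lebesgue_singleton a

theorem ae_mem_lebesgueTo (t : ℝ≥0) : ∀ᵐ s ∂lebesgueTo t, s ≤ t :=
  (ae_restrict_mem measurableSet_Icc).mono fun _ h => h.2

theorem lebesgueTo_real_Ioc {t a b : ℝ≥0} :
    (lebesgueTo t).real (Set.Ioc a b) = max (((min b t : ℝ≥0) : ℝ) - a) 0 := by
  rw [measureReal_def, Measure.restrict_apply measurableSet_Ioc]
  have : Set.Ioc a b ∩ Set.Icc 0 t = Set.Ioc a (min b t) := by
    ext x; simp; tauto
  rw [this, lebesgue_Ioc, ENNReal.toReal_ofReal']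

end Lebesgue

/-! ### Modification on null sets -/

section Null

variable {Ω : Type*} {mΩ : MeasurableSpace Ω} {𝓕 : Filtration ℝ≥0 mΩ} {P : Measure Ω}
  {H : Type*} [NormedAddCommGroup H] [SecondCountableTopology H]

/-- A preimage under `f` differs from the one under `g` only inside the set where `f ≠ g`, and by
completeness every subset of that null set lies in `𝓕 0`. This is what makes chosen representatives
of L² classes genuinely adapted. -/
theorem UsualConditions.stronglyMeasurable_of_ae_eq (h : UsualConditions 𝓕 P) {t : ℝ≥0}
    {f g : Ω → H} (hg : StronglyMeasurable[𝓕 t] g) (hfg : f =ᵐ[P] g) :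
    StronglyMeasurable[𝓕 t] f := by
  borelize H
  have hnull : ∀ s ⊆ {ω | f ω ≠ g ω}, MeasurableSet[𝓕 t] s := fun s hs =>
    𝓕.mono (zero_le : (0 : ℝ≥0) ≤ t) _ (h.complete s (measure_mono_null hs hfg))
  refine (Measurable.stronglyMeasurable (mα := 𝓕 t) ?_)
  intro B hB
  have : f ⁻¹' B = (g ⁻¹' B \ {ω | f ω ≠ g ω}) ∪ (f ⁻¹' B ∩ {ω | f ω ≠ g ω}) := by
    ext ω
    by_cases hω : f ω = g ω <;> simp [hω]
  rw [this]
  exact ((hg.measurable hB).diff (hnull _ le_rfl)).union (hnull _ Set.inter_subset_right)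

theorem UsualConditions.stronglyMeasurable_of_mem_lpMeas [NormedSpace ℝ H]
    (h : UsualConditions 𝓕 P)
    {t : ℝ≥0} {f : Ω → H} {g : Lp H 2 P} (hg : g ∈ lpMeas H ℝ (𝓕 t) 2 P) (hfg : f =ᵐ[P] g) :
    StronglyMeasurable[𝓕 t] f := by
  have hg' := mem_lpMeas_iff_aestronglyMeasurable.1 hg
  exact h.stronglyMeasurable_of_ae_eq hg'.stronglyMeasurable_mk (hfg.trans hg'.ae_eq_mk)

end Null

/-! ### Mean-square norms and Gram matrices -/

section SquareNorm

variable {α : Type*} {mα : MeasurableSpace α} {μ : Measure α}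
  {H : Type*} [NormedAddCommGroup H]

theorem eLpNorm_two_sq (f : α → H) : eLpNorm f 2 μ ^ 2 = ∫⁻ a, ‖f a‖ₑ ^ 2 ∂μ := by
  have := eLpNorm_nnreal_pow_eq_lintegral (μ := μ) (f := f) (p := 2) two_ne_zero
  simpa using this

theorem tendsto_zero_of_sq {ι : Type*} {l : Filter ι} {u : ι → ℝ≥0∞}
    (h : Tendsto (fun i => u i ^ 2) l (𝓝 0)) : Tendsto u l (𝓝 0) := by
  have h1 := h.ennrpow_const (1 / 2)
  rw [ENNReal.zero_rpow_of_pos (by norm_num)] at h1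
  refine h1.congr fun i => ?_
  rw [← ENNReal.rpow_natCast, ← ENNReal.rpow_mul]
  norm_num

theorem eLpNorm_two_sq_eq_integral {f : α → H} (hf : MemLp f 2 μ) :
    eLpNorm f 2 μ ^ 2 = ENNReal.ofReal (∫ a, ‖f a‖ ^ 2 ∂μ) := by
  rw [eLpNorm_two_sq, ofReal_integral_eq_lintegral_ofReal
    ((memLp_two_iff_integrable_sq_norm hf.1).1 hf) (ae_of_all _ fun _ => by positivity)]
  refine lintegral_congr fun a => ?_
  rw [ENNReal.ofReal_pow (norm_nonneg _), ofReal_norm]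

theorem eLpNorm_two_le_iff {β : Type*} {mβ : MeasurableSpace β} {ν : Measure β} {F : Type*}
    [NormedAddCommGroup F] {f : α → H} {g : β → F} {c : ℝ≥0} :
    eLpNorm f 2 μ ≤ c * eLpNorm g 2 ν ↔
      ∫⁻ a, ‖f a‖ₑ ^ 2 ∂μ ≤ (c : ℝ≥0∞) ^ 2 * ∫⁻ b, ‖g b‖ₑ ^ 2 ∂ν := by
  rw [← eLpNorm_two_sq, ← eLpNorm_two_sq, ← mul_pow]
  exact (ENNReal.pow_right_strictMono two_ne_zero).le_iff_le.symm

variable [InnerProductSpace ℝ H]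

theorem integrable_inner_of_memLp {f g : α → H} (hf : MemLp f 2 μ) (hg : MemLp g 2 μ) :
    Integrable (fun a => inner ℝ (f a) (g a)) μ := by
  refine (hf.norm.integrable_mul hg.norm).mono (hf.1.inner hg.1) (ae_of_all _ fun a => ?_)
  simpa using abs_real_inner_le_norm (f a) (g a)

theorem integral_norm_sq_linearCombination {ι : Type*} {u : ι → α → H}
    (hu : ∀ i, MemLp (u i) 2 μ) (x : ι →₀ ℝ) :
    ∫ a, ‖Finsupp.linearCombination ℝ u x a‖ ^ 2 ∂μ
      = ∑ i ∈ x.support, ∑ j ∈ x.support, x i * (x j * ∫ a, inner ℝ (u i a) (u j a) ∂μ) := by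
  have : ∀ a, ‖Finsupp.linearCombination ℝ u x a‖ ^ 2
      = ∑ i ∈ x.support, ∑ j ∈ x.support, x i * (x j * inner ℝ (u i a) (u j a)) := by
    intro a
    rw [Finsupp.linearCombination_apply, Finsupp.sum, Finset.sum_apply,
      ← real_inner_self_eq_norm_sq, sum_inner]
    refine Finset.sum_congr rfl fun i _ => ?_
    rw [inner_sum]
    refine Finset.sum_congr rfl fun j _ => ?_
    simp only [Pi.smul_apply, real_inner_smul_left, real_inner_smul_right]
    ring
  have hint : ∀ i j, Integrable (fun a => x i * (x j * inner ℝ (u i a) (u j a))) μ :=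
    fun i j => ((integrable_inner_of_memLp (hu i) (hu j)).const_mul _).const_mul _
  simp_rw [this]
  rw [integral_finsetSum _ fun i _ => integrable_finsetSum _ fun j _ => hint i j]
  refine Finset.sum_congr rfl fun i _ => ?_
  rw [integral_finsetSum _ fun j _ => hint i j]
  refine Finset.sum_congr rfl fun j _ => ?_
  rw [integral_const_mul, integral_const_mul]

/-- If two families have proportional Gram matrices, then the square norms of their linear
combinations are proportional. -/
theorem integral_norm_sq_linearCombination_eq {ι β : Type*} {mβ : MeasurableSpace β}
    {ν : Measure β} {f : ι → α → H} {g : ι → β → H} (hf : ∀ i, MemLp (f i) 2 μ)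
    (hg : ∀ i, MemLp (g i) 2 ν) {c : ℝ}
    (h : ∀ i j, ∫ a, inner ℝ (f i a) (f j a) ∂μ = c * ∫ b, inner ℝ (g i b) (g j b) ∂ν)
    (x : ι →₀ ℝ) :
    ∫ a, ‖Finsupp.linearCombination ℝ f x a‖ ^ 2 ∂μ
      = c * ∫ b, ‖Finsupp.linearCombination ℝ g x b‖ ^ 2 ∂ν := by
  rw [integral_norm_sq_linearCombination hf, integral_norm_sq_linearCombination hg, Finset.mul_sum]
  refine Finset.sum_congr rfl fun i _ => ?_
  rw [Finset.mul_sum]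
  refine Finset.sum_congr rfl fun j _ => ?_
  rw [h]; ring

end SquareNorm

end LevyCurve

/-! ### Atoms, step processes and mean-square bounded integrators -/

namespace LevyCurve

/-- A process `ψ 1_{(s,u]}` with a square-integrable `𝓕 s`-measurable `ψ`. -/
structure Atom {Ω : Type*} {mΩ : MeasurableSpace Ω} (𝓕 : Filtration ℝ≥0 mΩ) (P : Measure Ω)
    (H : Type*) [NormedAddCommGroup H] where
  left : ℝ≥0
  right : ℝ≥0
  le : left ≤ right
  val : Ω → H
  measurable : StronglyMeasurable[𝓕 left] val
  memLp : MemLp val 2 P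

namespace Atom

variable {Ω : Type*} {mΩ : MeasurableSpace Ω} {𝓕 : Filtration ℝ≥0 mΩ} {P : Measure Ω}
  {H : Type*} [NormedAddCommGroup H]

/-- The atom as a function of time and chance. -/
noncomputable def eval (a : Atom 𝓕 P H) (p : ℝ≥0 × Ω) : H :=
  (Set.Ioc a.left a.right).indicator (fun _ => a.val p.2) p.1

/-- The integral of the atom over `[0,t]` against the integrator `A`. -/
noncomputable def integral [NormedSpace ℝ H] (A : ℝ≥0 → Ω → ℝ) (t : ℝ≥0) (a : Atom 𝓕 P H)
    (ω : Ω) : H :=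
  (A (min a.right t) ω - A (min a.left t) ω) • a.val ω

/-- The part of the atom after time `s` and before time `t`. -/
noncomputable def slice (a : Atom 𝓕 P H) (s t : ℝ≥0) : Atom 𝓕 P H where
  left := max s a.left
  -- The outer `max` keeps the endpoints ordered when the atom misses `(s,t]`; the slice is then
  -- empty.
  right := max (max s a.left) (min a.right t)
  le := le_max_left _ _
  val := a.val
  measurable := a.measurable.mono (𝓕.mono (le_max_right _ _))
  memLp := a.memLp

/-- Reduces statements on increments of integrals (regularity in time, orthogonality to the past) to
a single increment of `A` that starts no earlier than `s`. -/
theorem integral_sub_integral [NormedSpace ℝ H] (A : ℝ≥0 → Ω → ℝ) {s t : ℝ≥0} (h : s ≤ t)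
    (a : Atom 𝓕 P H) (ω : Ω) : a.integral A t ω - a.integral A s ω
      = (A (a.slice s t).right ω - A (a.slice s t).left ω) • a.val ω := by
  have hle := a.le
  simp only [integral, slice, ← sub_smul]
  congr 1
  rcases le_total a.right s with h1 | h1
  · have h2 := hle.trans h1
    simp [h1, h2, h1.trans h, h2.trans h]
  rcases le_total a.left s with h2 | h2
  · simp [h1, h2, h2.trans h, h]
  rcases le_total a.left t with h3 | h3
  · have : a.left ≤ min a.right t := le_min hle h3
    simp [h1, h2, h3, this]
  · have : min a.right t ≤ a.left := (min_le_right _ _).trans h3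
    simp [h1, h2, h3, h3.trans hle]

theorem integral_slice [NormedSpace ℝ H] (A : ℝ≥0 → Ω → ℝ) {s t : ℝ≥0} (h : s ≤ t)
    (a : Atom 𝓕 P H) :
    (a.slice s t).integral A t = fun ω => a.integral A t ω - a.integral A s ω := by
  ext ω
  rw [integral_sub_integral A h]
  simp only [integral, slice]
  congr 1
  rcases le_total (max s a.left) t with h1 | h1
  · rw [min_eq_left h1, min_eq_left (max_le h1 (min_le_right _ _))]
  · have : min a.right t ≤ max s a.left := (min_le_right _ _).trans h1
    rw [min_eq_right h1, max_eq_left this, min_eq_right h1]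
    simp

theorem eval_eq (a : Atom 𝓕 P H) :
    a.eval = (Set.Ioc a.left a.right ×ˢ Set.univ).indicator fun p => a.val p.2 := by
  ext p
  by_cases h : p.1 ∈ Set.Ioc a.left a.right <;> simp only [eval, h, Set.indicator, Set.mem_prod,
    Set.mem_univ, and_self, and_true, if_true, if_false]

variable [IsProbabilityMeasure P]

theorem memLp_eval (a : Atom 𝓕 P H) (ν : Measure ℝ≥0) [IsFiniteMeasure ν] :
    MemLp a.eval 2 (ν.prod P) := by
  rw [eval_eq]
  exact (a.memLp.comp_snd ν).indicator (measurableSet_Ioc.prod MeasurableSet.univ)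

theorem lintegral_eval_sq (a : Atom 𝓕 P H) (ν : Measure ℝ≥0) [IsFiniteMeasure ν] :
    ∫⁻ p, ‖a.eval p‖ₑ ^ 2 ∂ν.prod P
      = ν (Set.Ioc a.left a.right) * ∫⁻ ω, ‖a.val ω‖ₑ ^ 2 ∂P := by
  have : ∀ p : ℝ≥0 × Ω, ‖a.eval p‖ₑ ^ 2
      = (Set.Ioc a.left a.right).indicator 1 p.1 * ‖a.val p.2‖ₑ ^ 2 := by
    intro p
    by_cases h : p.1 ∈ Set.Ioc a.left a.right <;> simp [eval, h]
  simp_rw [this]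
  rw [lintegral_prod_mul (measurable_one.indicator measurableSet_Ioc).aemeasurable
    (a.memLp.1.enorm.pow_const 2), lintegral_indicator_one measurableSet_Ioc]

variable [InnerProductSpace ℝ H]

/-- The product of the two indicators is that of the overlap, so the integral factors into overlap
length times `E⟨ψ, φ⟩`. The maximum with `0` accounts for disjoint atoms. -/
theorem integral_inner_eval (a b : Atom 𝓕 P H) (t : ℝ≥0) :
    ∫ p, inner ℝ (a.eval p) (b.eval p) ∂(lebesgueTo t).prod P
      = max (((min (min a.right b.right) t : ℝ≥0) : ℝ) - (max a.left b.left : ℝ≥0)) 0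
        * ∫ ω, inner ℝ (a.val ω) (b.val ω) ∂P := by
  have : ∀ p : ℝ≥0 × Ω, inner ℝ (a.eval p) (b.eval p)
      = (Set.Ioc (max a.left b.left) (min a.right b.right)).indicator (1 : ℝ≥0 → ℝ) p.1
        * inner ℝ (a.val p.2) (b.val p.2) := by
    intro p
    rw [← Set.Ioc_inter_Ioc]
    by_cases h : p.1 ∈ Set.Ioc a.left a.right <;>
      by_cases h' : p.1 ∈ Set.Ioc b.left b.right <;> simp [eval, h, h']
  simp_rw [this]
  rw [integral_prod_mul ((Set.Ioc (max a.left b.left) (min a.right b.right)).indicator (1 : ℝ≥0 → ℝ))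
    (fun ω => inner ℝ (a.val ω) (b.val ω)), integral_indicator_one measurableSet_Ioc,
    lebesgueTo_real_Ioc]

end Atom

section

variable {Ω : Type*} {mΩ : MeasurableSpace Ω} {𝓕 : Filtration ℝ≥0 mΩ} {P : Measure Ω}
  {H : Type*} [NormedAddCommGroup H] [InnerProductSpace ℝ H]

/-- A formal linear combination of atoms as a function of time and chance. -/
noncomputable def stepEval : (Atom 𝓕 P H →₀ ℝ) →ₗ[ℝ] (ℝ≥0 × Ω → H) :=
  Finsupp.linearCombination ℝ Atom.eval

/-- The integral over `[0,t]` of a formal linear combination of atoms. -/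
noncomputable def stepIntegral (A : ℝ≥0 → Ω → ℝ) (t : ℝ≥0) :
    (Atom 𝓕 P H →₀ ℝ) →ₗ[ℝ] (Ω → H) :=
  Finsupp.linearCombination ℝ (Atom.integral A t)

theorem memLp_linearCombination {ι α : Type*} {mα : MeasurableSpace α} {μ : Measure α}
    {u : ι → α → H} (hu : ∀ i, MemLp (u i) 2 μ) (x : ι →₀ ℝ) :
    MemLp (Finsupp.linearCombination ℝ u x) 2 μ := by
  rw [Finsupp.linearCombination_apply, Finsupp.sum]
  exact memLp_finsetSum' _ fun i _ => (hu i).const_smul _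

theorem memLp_stepEval [IsProbabilityMeasure P] (x : Atom 𝓕 P H →₀ ℝ) (ν : Measure ℝ≥0)
    [IsFiniteMeasure ν] :
    MemLp (stepEval x) 2 (ν.prod P) :=
  memLp_linearCombination (fun a => a.memLp_eval ν) x

theorem stepEval_apply (x : Atom 𝓕 P H →₀ ℝ) (p : ℝ≥0 × Ω) :
    stepEval x p = ∑ a ∈ x.support, x a • a.eval p := by
  rw [stepEval, Finsupp.linearCombination_apply, Finsupp.sum, Finset.sum_apply]; rfl

theorem stepIntegral_apply (A : ℝ≥0 → Ω → ℝ) (t : ℝ≥0) (x : Atom 𝓕 P H →₀ ℝ) (ω : Ω) :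
    stepIntegral A t x ω = ∑ a ∈ x.support, x a • a.integral A t ω := by
  rw [stepIntegral, Finsupp.linearCombination_apply, Finsupp.sum, Finset.sum_apply]; rfl

theorem stepEval_single_one (a : Atom 𝓕 P H) : stepEval (Finsupp.single a 1) = a.eval := by
  rw [stepEval, Finsupp.linearCombination_single, one_smul]

theorem stepIntegral_single_one (A : ℝ≥0 → Ω → ℝ) (t : ℝ≥0) (a : Atom 𝓕 P H) :
    stepIntegral A t (Finsupp.single a 1) = a.integral A t := by
  rw [stepIntegral, Finsupp.linearCombination_single, one_smul]

variable (𝓕 P H) in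
/-- `A` is an adapted integrator for which the integrals of step processes over subintervals of
`[0,T]` are bounded in mean square by the integrands. -/
structure IsL2Integrator (A : ℝ≥0 → Ω → ℝ) (T : ℝ≥0) (C : ℝ≥0) : Prop where
  adapted : StronglyAdapted 𝓕 A
  memLp : ∀ (a : Atom 𝓕 P H) (t : ℝ≥0), MemLp (a.integral A t) 2 P
  -- Applied to a difference of formal combinations, the bound also shows that the integral depends,
  -- almost surely, only on the process represented.
  bound : ∀ t ≤ T, ∀ x : Atom 𝓕 P H →₀ ℝ,
    eLpNorm (stepIntegral A t x) 2 P ≤ C * eLpNorm (stepEval x) 2 ((lebesgueTo t).prod P)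

namespace IsL2Integrator

variable {A : ℝ≥0 → Ω → ℝ} {T C : ℝ≥0}

theorem memLp_stepIntegral (h : IsL2Integrator 𝓕 P H A T C) (x : Atom 𝓕 P H →₀ ℝ) (t : ℝ≥0) :
    MemLp (stepIntegral A t x) 2 P :=
  memLp_linearCombination (fun a => h.memLp a t) x

/-- The value of an atom starting after `t` need not be `𝓕 t`-measurable, but then both truncated
times equal `t` and the increment vanishes. -/
theorem stronglyMeasurable_integral (h : IsL2Integrator 𝓕 P H A T C) (a : Atom 𝓕 P H) (t : ℝ≥0) :
    StronglyMeasurable[𝓕 t] (a.integral A t) := by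
  rcases le_total a.left t with h1 | h1
  · have hA : ∀ r ≤ t, StronglyMeasurable[𝓕 t] (A r) := fun r hr =>
      (h.adapted r).mono (𝓕.mono hr)
    exact ((hA _ (min_le_right _ _)).sub (hA _ (min_le_right _ _))).smul
      (a.measurable.mono (𝓕.mono h1))
  · have : a.integral A t = fun _ => 0 := by
      ext ω
      simp [Atom.integral, h1, h1.trans a.le]
    rw [this]
    exact stronglyMeasurable_const

theorem stronglyMeasurable_stepIntegral (h : IsL2Integrator 𝓕 P H A T C)
    (x : Atom 𝓕 P H →₀ ℝ) (t : ℝ≥0) : StronglyMeasurable[𝓕 t] (stepIntegral A t x) := by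
  rw [stepIntegral, Finsupp.linearCombination_apply, Finsupp.sum]
  exact Finset.stronglyMeasurable_sum _ fun a _ =>
    (h.stronglyMeasurable_integral a t).const_smul (x a)

theorem eLpNorm_atom_sub_le [IsProbabilityMeasure P] (h : IsL2Integrator 𝓕 P H A T C)
    (a : Atom 𝓕 P H) {s t : ℝ≥0} (hst : s ≤ t) (htT : t ≤ T) :
    ∫⁻ ω, ‖a.integral A t ω - a.integral A s ω‖ₑ ^ 2 ∂P
      ≤ (C : ℝ≥0∞) ^ 2 * (ENNReal.ofReal (t - s) * ∫⁻ ω, ‖a.val ω‖ₑ ^ 2 ∂P) := by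
  have h1 := h.bound t htT (Finsupp.single (a.slice s t) 1)
  rw [stepIntegral_single_one, stepEval_single_one, Atom.integral_slice A hst,
    eLpNorm_two_le_iff, Atom.lintegral_eval_sq] at h1
  refine h1.trans ?_
  gcongr
  · rw [Measure.restrict_apply measurableSet_Ioc, ← lebesgue_Ioc]
    refine measure_mono fun r hr => ⟨(le_max_left s a.left).trans_lt hr.1.1, hr.2.2⟩
  · rfl

/-- Each atom contributes a curve that is Hölder of order 1/2 in mean square, by the bound on its
slice; finitely many atoms are summed by the triangle inequality. -/
theorem tendsto_eLpNorm_stepIntegral_sub [IsProbabilityMeasure P]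
    (h : IsL2Integrator 𝓕 P H A T C) (x : Atom 𝓕 P H →₀ ℝ) (s : Set.Icc (0 : ℝ≥0) T) :
    Tendsto (fun t : Set.Icc (0 : ℝ≥0) T =>
      eLpNorm (stepIntegral A t x - stepIntegral A s x) 2 P) (𝓝 s) (𝓝 0) := by
  have hatom : ∀ a : Atom 𝓕 P H, Tendsto (fun t : Set.Icc (0 : ℝ≥0) T =>
      eLpNorm (a.integral A t - a.integral A s) 2 P) (𝓝 s) (𝓝 0) := by
    intro a
    have hb : ∀ t : Set.Icc (0 : ℝ≥0) T, eLpNorm (a.integral A t - a.integral A s) 2 P ^ 2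
        ≤ (C : ℝ≥0∞) ^ 2 * (ENNReal.ofReal |((t : ℝ≥0) : ℝ) - (s : ℝ≥0)|
          * ∫⁻ ω, ‖a.val ω‖ₑ ^ 2 ∂P) := by
      intro t
      rw [eLpNorm_two_sq]
      rcases le_total s t with hst | hst
      · rw [abs_of_nonneg (sub_nonneg.2 (mod_cast hst))]
        exact h.eLpNorm_atom_sub_le a hst t.2.2
      · rw [abs_sub_comm, abs_of_nonneg (sub_nonneg.2 (mod_cast hst))]
        refine le_trans (le_of_eq ?_) (h.eLpNorm_atom_sub_le a hst s.2.2)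
        refine lintegral_congr fun ω => ?_
        rw [Pi.sub_apply, ← enorm_neg, neg_sub]
    have hfin : ∫⁻ ω, ‖a.val ω‖ₑ ^ 2 ∂P ≠ ∞ := by
      rw [← eLpNorm_two_sq]; exact ENNReal.pow_ne_top a.memLp.2.ne
    have h0 : Tendsto (fun t : Set.Icc (0 : ℝ≥0) T => (C : ℝ≥0∞) ^ 2 *
        (ENNReal.ofReal |((t : ℝ≥0) : ℝ) - (s : ℝ≥0)| * ∫⁻ ω, ‖a.val ω‖ₑ ^ 2 ∂P)) (𝓝 s) (𝓝 0) := by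
      have h1 : Tendsto (fun t : Set.Icc (0 : ℝ≥0) T =>
          ENNReal.ofReal |((t : ℝ≥0) : ℝ) - (s : ℝ≥0)|) (𝓝 s) (𝓝 0) := by
        have : Continuous fun t : Set.Icc (0 : ℝ≥0) T =>
          ENNReal.ofReal |((t : ℝ≥0) : ℝ) - (s : ℝ≥0)| :=
          ENNReal.continuous_ofReal.comp (by fun_prop)
        simpa using this.tendsto s
      have h2 := ENNReal.Tendsto.mul_const h1 (Or.inr hfin)
      have h3 := ENNReal.Tendsto.const_mul (a := (C : ℝ≥0∞) ^ 2) h2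
        (Or.inr (ENNReal.pow_ne_top ENNReal.coe_ne_top))
      simpa using h3
    have hsq := tendsto_of_tendsto_of_tendsto_of_le_of_le tendsto_const_nhds h0
      (fun _ => zero_le) hb
    exact tendsto_zero_of_sq hsq
  have hsum : Tendsto (fun t : Set.Icc (0 : ℝ≥0) T => ∑ a ∈ x.support,
      ‖x a‖ₑ * eLpNorm (a.integral A t - a.integral A s) 2 P) (𝓝 s) (𝓝 0) := by
    have := tendsto_finsetSum x.support fun a _ =>
      ENNReal.Tendsto.const_mul (a := ‖x a‖ₑ) (hatom a) (Or.inr enorm_ne_top)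
    simpa using this
  refine tendsto_of_tendsto_of_tendsto_of_le_of_le tendsto_const_nhds hsum (fun _ => zero_le) ?_
  intro t
  have : stepIntegral A t x - stepIntegral A s x
      = ∑ a ∈ x.support, x a • (a.integral A t - a.integral A s) := by
    ext ω
    simp only [Pi.sub_apply, stepIntegral_apply, ← Finset.sum_sub_distrib, Finset.sum_apply,
      Pi.smul_apply, smul_sub]
  beta_reduce
  rw [this]
  refine (eLpNorm_sum_le (fun a _ => ((h.memLp a t).1.sub (h.memLp a s).1).const_smul _)
    one_le_two).trans (Finset.sum_le_sum fun a _ => ?_)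
  rw [eLpNorm_const_smul]

end IsL2Integrator

end

end LevyCurve

/-! ### Mean, variance and decomposition of a Lévy process -/

namespace LevyCurve

section Additive

/-- Cauchy's functional equation: `x ↦ f x⁺ - f x⁻` is an additive function on `ℝ`, continuous at
`0`, hence linear. -/
theorem eq_mul_of_additive_of_tendsto {f : ℝ≥0 → ℝ} (hadd : ∀ s t, f (s + t) = f s + f t)
    (h0 : Tendsto f (𝓝 0) (𝓝 0)) (t : ℝ≥0) : f t = f 1 * t := by
  have hz : f 0 = 0 := by simpa using hadd 0 0
  let F : ℝ →+ ℝ :=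
    { toFun := fun x => f x.toNNReal - f (-x).toNNReal
      map_zero' := by simp
      map_add' := by
        intro x y
        -- Negative parts are moved across so that `f` is only applied to sums in `ℝ≥0`.
        have : (x + y).toNNReal + (-x).toNNReal + (-y).toNNReal
            = (-(x + y)).toNNReal + x.toNNReal + y.toNNReal := by
          rw [← NNReal.coe_inj]
          push_cast [Real.coe_toNNReal']
          have h1 := max_zero_sub_eq_self x
          have h2 := max_zero_sub_eq_self y
          have h3 := max_zero_sub_eq_self (x + y)
          rw [max_comm] at h1 h2 h3
          simp only [max_comm] at *
          linarith
        have := congrArg f this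
        simp only [hadd] at this
        linarith }
  have hF : Continuous F := by
    refine continuous_of_continuousAt_zero F ?_
    have h1 : Tendsto (fun x : ℝ => f x.toNNReal) (𝓝 0) (𝓝 0) :=
      h0.comp (by simpa using (continuous_real_toNNReal.tendsto (0 : ℝ)))
    have h2 : Tendsto (fun x : ℝ => f (-x).toNNReal) (𝓝 0) (𝓝 0) :=
      h1.comp (by simpa using (continuous_neg.tendsto (0 : ℝ)))
    have := h1.sub h2
    change Tendsto F (𝓝 0) (𝓝 (F 0))
    rw [map_zero]
    rw [sub_zero] at this
    exact this
  have key := (F.toRealLinearMap hF).map_smul (t : ℝ) 1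
  simp only [smul_eq_mul, mul_one, AddMonoidHom.coe_toRealLinearMap] at key
  have h1 : ∀ s : ℝ≥0, F s = f s := by
    intro s
    have : (-(s : ℝ)).toNNReal = 0 := Real.toNNReal_of_nonpos (by simp)
    simp [F, this, hz]
  rw [h1] at key
  have h2 := h1 1
  rw [NNReal.coe_one] at h2
  rw [h2] at key
  rw [key, mul_comm]

/-- Nonnegativity makes `f` monotone, and `(n+1) f(1/(n+1)) = f 1` then forces continuity at `0`. -/
theorem eq_mul_of_additive_of_nonneg {f : ℝ≥0 → ℝ} (hadd : ∀ s t, f (s + t) = f s + f t)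
    (hnn : ∀ t, 0 ≤ f t) (t : ℝ≥0) : f t = f 1 * t := by
  refine eq_mul_of_additive_of_tendsto hadd ?_ t
  have hz : f 0 = 0 := by simpa using hadd 0 0
  have hmono : Monotone f := by
    intro s t hst
    rw [← add_tsub_cancel_of_le hst, hadd]
    linarith [hnn (t - s)]
  have hnat : ∀ (n : ℕ) (s : ℝ≥0), f (n * s) = n * f s := by
    intro n s
    induction n with
    | zero => simp [hz]
    | succ n ih => push_cast; rw [add_mul, one_mul, hadd, ih]; ring
  rw [Metric.tendsto_nhds]
  intro ε hε
  obtain ⟨n, hn⟩ := exists_nat_gt (f 1 / ε)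
  have hn1 : (0 : ℝ) < n + 1 := by positivity
  have hpos : (0 : ℝ≥0) < 1 / (n + 1 : ℕ) := by positivity
  filter_upwards [Iic_mem_nhds hpos] with s hs
  have h1 := hmono hs
  have h2 := hnat (n + 1) (1 / (n + 1 : ℕ))
  rw [mul_one_div_cancel (by positivity)] at h2
  rw [Real.dist_eq, sub_zero, abs_of_nonneg (hnn s)]
  push_cast at h2 h1
  rw [div_lt_iff₀ hε] at hn
  nlinarith [hnn s]

end Additive

variable {Ω : Type*} {mΩ : MeasurableSpace Ω} {𝓕 : Filtration ℝ≥0 mΩ} {P : Measure Ω} {X : ℝ≥0 → Ω → ℝ}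

namespace IsSquareIntegrableLevy

theorem indepFun_sub {E : Type*} [MeasurableSpace E] (h : IsSquareIntegrableLevy 𝓕 P X)
    {s t : ℝ≥0} (hst : s ≤ t)
    {ξ : Ω → E} (hξ : Measurable[𝓕 s] ξ) : IndepFun ξ (fun ω => X t ω - X s ω) P := by
  rw [IndepFun_iff_Indep]
  exact (indep_of_indep_of_le_right (h.indep s t hst) hξ.comap_le).symm

theorem memLp_sub (h : IsSquareIntegrableLevy 𝓕 P X) (s t : ℝ≥0) :
    MemLp (fun ω => X t ω - X s ω) 2 P := (h.memLp t).sub (h.memLp s)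

/-- Independent stationary increments make the variance additive in time; being nonnegative, it is
linear without any appeal to path regularity. -/
theorem variance_eq (h : IsSquareIntegrableLevy 𝓕 P X) (t : ℝ≥0) :
    Var[X t; P] = Var[X 1; P] * t := by
  refine eq_mul_of_additive_of_nonneg (f := fun t => Var[X t; P]) (fun s t => ?_)
    (fun t => variance_nonneg _ _) t
  have h1 := (h.indepFun_sub (le_self_add : s ≤ s + t) (h.adapted s).measurable).variance_add
    (h.memLp s) (h.memLp_sub s (s + t))
  rw [(h.stationary s t).variance_eq] at h1
  rw [← h1]
  congr 1
  ext ω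
  simp

variable [IsProbabilityMeasure P]

theorem mean_add (h : IsSquareIntegrableLevy 𝓕 P X) (s t : ℝ≥0) :
    ∫ ω, X (s + t) ω ∂P = ∫ ω, X s ω ∂P + ∫ ω, X t ω ∂P := by
  rw [← (h.stationary s t).integral_eq, ← integral_add
    ((h.memLp s).integrable one_le_two) ((h.memLp_sub s (s + t)).integrable one_le_two)]
  simp

/-- The mean is additive but has no sign, so continuity at `0` must be proved. As the variance is
linear, `X t - E X t → 0` in L² as `t ↓ 0`, hence almost surely along a subsequence, while
right-continuity gives `X t → 0`; so the means tend to `0`. -/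
theorem mean_eq (h : IsSquareIntegrableLevy 𝓕 P X) (t : ℝ≥0) :
    ∫ ω, X t ω ∂P = (∫ ω, X 1 ω ∂P) * t := by
  refine eq_mul_of_additive_of_tendsto (f := fun t => ∫ ω, X t ω ∂P) h.mean_add ?_ t
  have hz : ∫ ω, X 0 ω ∂P = 0 := by
    rw [integral_congr_ae h.zero]; simp
  have hgt : Tendsto (fun t => ∫ ω, X t ω ∂P) (𝓝[>] 0) (𝓝 0) := by
    refine tendsto_of_subseq_tendsto fun u hu => ?_
    have hu0 : Tendsto u atTop (𝓝 0) := hu.mono_right nhdsWithin_le_nhds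
    have hL2 : Tendsto (fun n => eLpNorm ((fun ω => X (u n) ω - ∫ ω', X (u n) ω' ∂P) - 0) 2 P)
        atTop (𝓝 0) := by
      have heq : ∀ n, eLpNorm ((fun ω => X (u n) ω - ∫ ω', X (u n) ω' ∂P) - 0) 2 P ^ 2
          = ENNReal.ofReal (Var[X 1; P] * u n) := by
        intro n
        have hmem : MemLp (fun ω => X (u n) ω - ∫ ω', X (u n) ω' ∂P) 2 P :=
          (h.memLp (u n)).sub (memLp_const _)
        rw [sub_zero, eLpNorm_two_sq_eq_integral hmem,
          ← h.variance_eq, variance_eq_integral (h.memLp (u n)).1.aemeasurable]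
        simp
      have h1 : Tendsto (fun n => ENNReal.ofReal (Var[X 1; P] * u n)) atTop (𝓝 0) := by
        have : Tendsto (fun n => Var[X 1; P] * (u n : ℝ)) atTop (𝓝 (Var[X 1; P] * (0 : ℝ≥0))) :=
          ((NNReal.continuous_coe.tendsto 0).comp hu0).const_mul _
        simpa using ENNReal.tendsto_ofReal this
      simp_rw [← heq] at h1
      exact tendsto_zero_of_sq h1
    have hm := tendstoInMeasure_of_tendsto_eLpNorm (p := 2) two_ne_zero
      (fun n => ((h.memLp (u n)).sub (memLp_const _)).1) aestronglyMeasurable_zero hL2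
    obtain ⟨ns, hns, hae⟩ := hm.exists_seq_tendsto_ae
    refine ⟨ns, ?_⟩
    -- The means are deterministic, so one good sample point suffices.
    obtain ⟨ω, hω1, hω2, hω3⟩ := (hae.and (h.cadlag.and h.zero)).exists
    have hX : Tendsto (fun n => X (u (ns n)) ω) atTop (𝓝 (X 0 ω)) :=
      ((hω2 0).1.tendsto.comp hu).comp hns.tendsto_atTop
    have := hX.sub hω1
    simpa [hω3] using this
  have := hgt.sup (f := fun t => ∫ ω, X t ω ∂P) (show Tendsto (fun t => ∫ ω, X t ω ∂P)
    (pure 0) (𝓝 0) by rw [tendsto_pure_left]; intro s hs; rw [hz]; exact mem_of_mem_nhds hs)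
  refine this.mono_left ?_
  have h1 : (𝓝 (0 : ℝ≥0)) = 𝓝[Set.Ici 0] 0 := by
    rw [← nhdsWithin_univ]; congr 1; ext x; simp
  rw [h1, ← Set.Ioi_insert, nhdsWithin_insert, sup_comm]

theorem martingale_of_integral_eq_zero (h : IsSquareIntegrableLevy 𝓕 P X)
    (h0 : ∀ t, ∫ ω, X t ω ∂P = 0) : Martingale X 𝓕 P := by
  refine ⟨h.adapted, fun s t hst => ?_⟩
  have h1 : P[fun ω => X t ω - X s ω|𝓕 s] =ᵐ[P] fun _ => ∫ ω, (X t ω - X s ω) ∂P := by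
    refine condExp_indep_eq (m₁ := MeasurableSpace.comap (fun ω => X t ω - X s ω) inferInstance)
      ?_ (𝓕.le s) ?_ (h.indep s t hst)
    · refine Measurable.comap_le ?_
      exact (((h.adapted t).mono (𝓕.le t)).sub ((h.adapted s).mono (𝓕.le s))).measurable
    · exact Measurable.stronglyMeasurable (comap_measurable _)
  have h2 : P[X t|𝓕 s] =ᵐ[P] P[fun ω => X t ω - X s ω|𝓕 s] + P[X s|𝓕 s] := by
    refine EventuallyEq.trans (condExp_congr_ae ?_) (condExp_add
      ((h.memLp_sub s t).integrable one_le_two) ((h.memLp s).integrable one_le_two) _)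
    exact ae_of_all _ fun ω => by simp
  have h3 : P[X s|𝓕 s] = X s :=
    condExp_of_stronglyMeasurable (𝓕.le s) (h.adapted s) ((h.memLp s).integrable one_le_two)
  rw [h3] at h2
  filter_upwards [h1, h2] with ω hω1 hω2
  rw [hω2, Pi.add_apply, hω1, integral_sub ((h.memLp t).integrable one_le_two)
    ((h.memLp s).integrable one_le_two), h0, h0]
  simp

theorem sub_drift (h : IsSquareIntegrableLevy 𝓕 P X) (b : ℝ) :
    IsSquareIntegrableLevy 𝓕 P (fun t ω => X t ω - b * t) where
  adapted t := (h.adapted t).sub stronglyMeasurable_const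
  zero := by filter_upwards [h.zero] with ω hω; simp [hω]
  indep s t hst := by
    refine indep_of_indep_of_le_left (h.indep s t hst) ?_
    have : (fun ω => X t ω - b * t - (X s ω - b * s))
        = (fun x => x - (b * t - b * s)) ∘ fun ω => X t ω - X s ω := by
      ext ω; simp; ring
    rw [this, ← MeasurableSpace.comap_comp]
    exact MeasurableSpace.comap_mono (measurable_id.sub_const _).comap_le
  stationary s t := by
    have := (h.stationary s t).comp (u := fun x => x - b * t) (measurable_id.sub_const _)
    convert this using 1
    · ext ω
      simp
      ring
    · rfl
  cadlag := by
    filter_upwards [h.cadlag] with ω hω t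
    have hc : Continuous fun t : ℝ≥0 => b * (t : ℝ) := by fun_prop
    refine ⟨(hω t).1.sub hc.continuousWithinAt, ?_⟩
    obtain ⟨l, hl⟩ := (hω t).2
    exact ⟨_, hl.sub (hc.continuousWithinAt (s := Set.Iio t)).tendsto⟩
  memLp t := (h.memLp t).sub (memLp_const _)

/-- The drift is `b = E X 1`. Linearity of the mean centres `X t - b t`, and centred independent
increments give the martingale property. -/
theorem exists_decomposition (h : IsSquareIntegrableLevy 𝓕 P X) :
    ∃ (M : ℝ≥0 → Ω → ℝ) (b : ℝ), IsLevyDecomposition 𝓕 P X M b := by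
  set b := ∫ ω, X 1 ω ∂P with hb
  refine ⟨fun t ω => X t ω - b * t, b, h.sub_drift b, ?_, fun t ω => by ring⟩
  refine (h.sub_drift b).martingale_of_integral_eq_zero fun t => ?_
  rw [integral_sub ((h.memLp t).integrable one_le_two) (integrable_const _), h.mean_eq, ← hb]
  simp

end IsSquareIntegrableLevy

end LevyCurve

/-! ### Itô isometry for step processes -/

namespace LevyCurve

variable {Ω : Type*} {mΩ : MeasurableSpace Ω} {𝓕 : Filtration ℝ≥0 mΩ} {P : Measure Ω}
  {M : ℝ≥0 → Ω → ℝ}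
  {H : Type*} [NormedAddCommGroup H] [InnerProductSpace ℝ H]

namespace IsSquareIntegrableLevy

theorem stronglyMeasurable_sub_smul (h : IsSquareIntegrableLevy 𝓕 P M) {r s t : ℝ≥0} {ψ : Ω → H}
    (hrs : r ≤ t) (hst : s ≤ t) (hψ : StronglyMeasurable[𝓕 t] ψ) :
    StronglyMeasurable[𝓕 t] (fun ω => (M s ω - M r ω) • ψ ω) := by
  have hA : ∀ r ≤ t, StronglyMeasurable[𝓕 t] (M r) := fun r hr => (h.adapted r).mono (𝓕.mono hr)
  exact ((hA _ hst).sub (hA _ hrs)).smul hψ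

/-- Independence is essential: a product of two L² functions is only in L¹, but here the squares of
the factors are independent and integrable. -/
theorem memLp_sub_smul (h : IsSquareIntegrableLevy 𝓕 P M) {s t : ℝ≥0} (hst : s ≤ t) {ψ : Ω → H}
    (hψ : StronglyMeasurable[𝓕 s] ψ) (hψ2 : MemLp ψ 2 P) :
    MemLp (fun ω => (M t ω - M s ω) • ψ ω) 2 P := by
  have hmeas : AEStronglyMeasurable (fun ω => (M t ω - M s ω) • ψ ω) P :=
    (h.memLp_sub s t).1.smul hψ2.1
  rw [memLp_two_iff_integrable_sq_norm hmeas]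
  have hind : IndepFun (fun ω => ‖ψ ω‖ ^ 2) (fun ω => (M t ω - M s ω) ^ 2) P :=
    (h.indepFun_sub hst hψ.norm.measurable).comp (φ := fun x => x ^ 2) (ψ := fun x => x ^ 2)
      (measurable_id.pow_const 2) (measurable_id.pow_const 2)
  have := hind.integrable_mul ((memLp_two_iff_integrable_sq_norm hψ2.1).1 hψ2)
    (h.memLp_sub s t).integrable_sq
  refine this.congr (ae_of_all _ fun ω => ?_)
  simp only [Pi.mul_apply, norm_smul, Real.norm_eq_abs, mul_pow, sq_abs]
  ring

variable [IsProbabilityMeasure P]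

theorem integral_eq_zero_of_martingale (h : IsSquareIntegrableLevy 𝓕 P M)
    (hM : Martingale M 𝓕 P) (t : ℝ≥0) : ∫ ω, M t ω ∂P = 0 := by
  have := hM.setIntegral_eq (zero_le : 0 ≤ t) (MeasurableSet.univ)
  rw [setIntegral_univ, setIntegral_univ] at this
  rw [← this, integral_congr_ae h.zero]
  simp

theorem integral_sub_eq_zero (h : IsSquareIntegrableLevy 𝓕 P M) (hM : Martingale M 𝓕 P)
    (s t : ℝ≥0) : ∫ ω, (M t ω - M s ω) ∂P = 0 := by
  rw [integral_sub ((h.memLp t).integrable one_le_two) ((h.memLp s).integrable one_le_two),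
    h.integral_eq_zero_of_martingale hM, h.integral_eq_zero_of_martingale hM, sub_zero]

theorem integral_sub_sq (h : IsSquareIntegrableLevy 𝓕 P M) (hM : Martingale M 𝓕 P)
    {s t : ℝ≥0} (hst : s ≤ t) :
    ∫ ω, (M t ω - M s ω) ^ 2 ∂P = Var[M 1; P] * ((t : ℝ) - s) := by
  have h1 := (h.stationary s (t - s)).variance_eq
  rw [h.variance_eq, variance_eq_integral (h.memLp_sub s _).1.aemeasurable,
    h.integral_sub_eq_zero hM, add_tsub_cancel_of_le hst, NNReal.coe_sub hst] at h1
  simpa using h1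

/-- The inner product `⟨ψ, φ⟩` is known at time `s`, hence independent of the centred increment. The
product formula for independent functions asks for no integrability, so no moments of `ψ` and `φ`
are required. -/
theorem integral_inner_sub_smul_eq_zero (h : IsSquareIntegrableLevy 𝓕 P M)
    (hM : Martingale M 𝓕 P) {s t : ℝ≥0} (hst : s ≤ t) {ψ φ : Ω → H}
    (hψ : StronglyMeasurable[𝓕 s] ψ) (hφ : StronglyMeasurable[𝓕 s] φ) :
    ∫ ω, inner ℝ ((M t ω - M s ω) • ψ ω) (φ ω) ∂P = 0 := by
  have hin : StronglyMeasurable[𝓕 s] fun ω => (inner ℝ (ψ ω) (φ ω) : ℝ) := hψ.inner hφ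
  simp_rw [real_inner_smul_left, mul_comm (M t _ - M s _)]
  rw [(h.indepFun_sub hst hin.measurable).integral_fun_mul_eq_mul_integral
    (hin.mono (𝓕.le s)).aestronglyMeasurable (h.memLp_sub s t).1, h.integral_sub_eq_zero hM,
    mul_zero]

theorem integral_inner_sub_smul_self (h : IsSquareIntegrableLevy 𝓕 P M)
    (hM : Martingale M 𝓕 P) {s t : ℝ≥0} (hst : s ≤ t) {ψ φ : Ω → H}
    (hψ : StronglyMeasurable[𝓕 s] ψ) (hφ : StronglyMeasurable[𝓕 s] φ) :
    ∫ ω, inner ℝ ((M t ω - M s ω) • ψ ω) ((M t ω - M s ω) • φ ω) ∂P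
      = Var[M 1; P] * ((t : ℝ) - s) * ∫ ω, inner ℝ (ψ ω) (φ ω) ∂P := by
  have hin : StronglyMeasurable[𝓕 s] fun ω => (inner ℝ (ψ ω) (φ ω) : ℝ) := hψ.inner hφ
  have hind : IndepFun (fun ω => (inner ℝ (ψ ω) (φ ω) : ℝ)) (fun ω => (M t ω - M s ω) ^ 2) P :=
    (h.indepFun_sub hst hin.measurable).comp (φ := id) (ψ := fun x => x ^ 2)
      measurable_id (measurable_id.pow_const 2)
  have : ∀ ω, inner ℝ ((M t ω - M s ω) • ψ ω) ((M t ω - M s ω) • φ ω)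
      = inner ℝ (ψ ω) (φ ω) * (M t ω - M s ω) ^ 2 := fun ω => by
    rw [real_inner_smul_left, real_inner_smul_right]; ring
  simp_rw [this]
  rw [hind.integral_fun_mul_eq_mul_integral (hin.mono (𝓕.le s)).aestronglyMeasurable
    ((h.memLp_sub s t).1.pow 2), h.integral_sub_sq hM hst, mul_comm]

/-- Two increments that start at the same time. -/
theorem integral_inner_sub_smul_of_le (h : IsSquareIntegrableLevy 𝓕 P M)
    (hM : Martingale M 𝓕 P) {s t u : ℝ≥0} (hst : s ≤ t) (htu : t ≤ u) {ψ φ : Ω → H}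
    (hψ : StronglyMeasurable[𝓕 s] ψ) (hψ2 : MemLp ψ 2 P)
    (hφ : StronglyMeasurable[𝓕 s] φ) (hφ2 : MemLp φ 2 P) :
    ∫ ω, inner ℝ ((M u ω - M s ω) • φ ω) ((M t ω - M s ω) • ψ ω) ∂P
      = Var[M 1; P] * ((t : ℝ) - s) * ∫ ω, inner ℝ (ψ ω) (φ ω) ∂P := by
  have h1 : ∀ ω, inner ℝ ((M u ω - M s ω) • φ ω) ((M t ω - M s ω) • ψ ω)
      = inner ℝ ((M u ω - M t ω) • φ ω) ((M t ω - M s ω) • ψ ω)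
        + inner ℝ ((M t ω - M s ω) • φ ω) ((M t ω - M s ω) • ψ ω) := fun ω => by
    rw [← inner_add_left, ← add_smul, sub_add_sub_cancel]
  simp_rw [h1]
  have hφt := hφ.mono (𝓕.mono hst)
  have hψt := hψ.mono (𝓕.mono hst)
  rw [integral_add (integrable_inner_of_memLp (h.memLp_sub_smul htu hφt hφ2)
      (h.memLp_sub_smul hst hψ hψ2))
    (integrable_inner_of_memLp (h.memLp_sub_smul hst hφ hφ2) (h.memLp_sub_smul hst hψ hψ2)),
    h.integral_inner_sub_smul_eq_zero hM htu hφt (h.stronglyMeasurable_sub_smul hst le_rfl hψt),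
    h.integral_inner_sub_smul_self hM hst hφ hψ, zero_add]
  simp_rw [real_inner_comm]

/-- By symmetry let `s ≤ s'`. If the intervals are disjoint, the first term is known at `s'` and
orthogonal to the second. Otherwise the first increment is split at `s'`: its early part is again
orthogonal, and the remaining two increments start together. -/
theorem integral_inner_sub_smul (h : IsSquareIntegrableLevy 𝓕 P M)
    (hM : Martingale M 𝓕 P) {s u s' u' : ℝ≥0} (hsu : s ≤ u) (hsu' : s' ≤ u') {ψ φ : Ω → H}
    (hψ : StronglyMeasurable[𝓕 s] ψ) (hψ2 : MemLp ψ 2 P)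
    (hφ : StronglyMeasurable[𝓕 s'] φ) (hφ2 : MemLp φ 2 P) :
    ∫ ω, inner ℝ ((M u ω - M s ω) • ψ ω) ((M u' ω - M s' ω) • φ ω) ∂P
      = Var[M 1; P] * max (((min u u' : ℝ≥0) : ℝ) - (max s s' : ℝ≥0)) 0
        * ∫ ω, inner ℝ (ψ ω) (φ ω) ∂P := by
  wlog hss : s ≤ s' generalizing s u s' u' ψ φ
  · have := this hsu' hsu hφ hφ2 hψ hψ2 (le_of_not_ge hss)
    rw [min_comm, max_comm s'] at this
    simp_rw [real_inner_comm] at this ⊢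
    exact this
  rcases le_total u s' with hus | hus
  · have hle : min u u' ≤ max s s' := (min_le_left _ _).trans (hus.trans (le_max_right _ _))
    rw [max_eq_right (sub_nonpos.2 (mod_cast hle)), mul_zero, zero_mul]
    simp_rw [real_inner_comm ((M u' _ - M s' _) • φ _)]
    rw [← h.integral_inner_sub_smul_eq_zero hM hsu' hφ
      (h.stronglyMeasurable_sub_smul hss hus (hψ.mono (𝓕.mono hss)))]
  · have hψ' := hψ.mono (𝓕.mono hss)
    have h1 : ∀ ω, inner ℝ ((M u ω - M s ω) • ψ ω) ((M u' ω - M s' ω) • φ ω)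
        = inner ℝ ((M u' ω - M s' ω) • φ ω) ((M s' ω - M s ω) • ψ ω)
          + inner ℝ ((M u' ω - M s' ω) • φ ω) ((M u ω - M s' ω) • ψ ω) := fun ω => by
      rw [← inner_add_right, ← add_smul, add_comm, sub_add_sub_cancel, real_inner_comm]
    simp_rw [h1]
    rw [integral_add (integrable_inner_of_memLp (h.memLp_sub_smul hsu' hφ hφ2)
        (h.memLp_sub_smul hss hψ hψ2))
      (integrable_inner_of_memLp (h.memLp_sub_smul hsu' hφ hφ2) (h.memLp_sub_smul hus hψ' hψ2)),
      h.integral_inner_sub_smul_eq_zero hM hsu' hφ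
        (h.stronglyMeasurable_sub_smul hss le_rfl hψ'), zero_add, max_eq_right hss]
    rcases le_total u u' with huu | huu
    · rw [h.integral_inner_sub_smul_of_le hM hus huu hψ' hψ2 hφ hφ2, min_eq_left huu,
        max_eq_left (sub_nonneg.2 (mod_cast hus))]
    · simp_rw [real_inner_comm ((M u _ - M s' _) • ψ _)]
      rw [h.integral_inner_sub_smul_of_le hM hsu' huu hφ hφ2 hψ' hψ2, min_eq_right huu,
        max_eq_left (sub_nonneg.2 (mod_cast hsu'))]
      simp_rw [real_inner_comm]

theorem memLp_atom_integral (h : IsSquareIntegrableLevy 𝓕 P M) (a : Atom 𝓕 P H) (t : ℝ≥0) :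
    MemLp (a.integral M t) 2 P := by
  rcases le_total a.left t with h1 | h1
  · unfold Atom.integral
    rw [min_eq_left h1]
    exact h.memLp_sub_smul (le_min a.le h1) a.measurable a.memLp
  · have : a.integral M t = fun _ => 0 := by
      ext ω
      simp [Atom.integral, h1, h1.trans a.le]
    rw [this]
    exact MemLp.zero

/-- The polarised Itô isometry: the Gram matrix of the integrals is `Var[M 1]` times that of the
integrands. Atoms starting after `t` contribute zero on both sides. -/
theorem integral_inner_atom (h : IsSquareIntegrableLevy 𝓕 P M) (hM : Martingale M 𝓕 P)
    (t : ℝ≥0) (a b : Atom 𝓕 P H) :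
    ∫ ω, inner ℝ (a.integral M t ω) (b.integral M t ω) ∂P
      = Var[M 1; P] * ∫ p, inner ℝ (a.eval p) (b.eval p) ∂(lebesgueTo t).prod P := by
  rw [Atom.integral_inner_eval, ← mul_assoc]
  by_cases hab : a.left ≤ t ∧ b.left ≤ t
  · unfold Atom.integral
    rw [min_eq_left hab.1, min_eq_left hab.2, h.integral_inner_sub_smul hM (le_min a.le hab.1)
      (le_min b.le hab.2) a.measurable a.memLp b.measurable b.memLp, ← inf_inf_distrib_right]
  · have hle : min (min a.right b.right) t ≤ max a.left b.left := by
      refine (min_le_right _ _).trans ?_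
      by_contra hc
      exact hab ⟨(le_max_left _ _).trans (le_of_not_ge hc), (le_max_right _ _).trans
        (le_of_not_ge hc)⟩
    rw [max_eq_right (sub_nonpos.2 (mod_cast hle)), mul_zero, zero_mul]
    rw [not_and_or] at hab
    have hz : ∀ c : Atom 𝓕 P H, ¬ c.left ≤ t → ∀ ω, c.integral M t ω = 0 := fun c hc ω => by
      have hc := le_of_not_ge hc
      simp [Atom.integral, hc, hc.trans c.le]
    rcases hab with hc | hc <;> simp [hz _ hc]

theorem isL2Integrator (h : IsSquareIntegrableLevy 𝓕 P M) (hM : Martingale M 𝓕 P) (T : ℝ≥0) :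
    IsL2Integrator 𝓕 P H M T (NNReal.sqrt (Var[M 1; P]).toNNReal) where
  adapted := h.adapted
  memLp := h.memLp_atom_integral
  bound t _ x := by
    have h1 := integral_norm_sq_linearCombination_eq (fun a => h.memLp_atom_integral a t)
      (fun a => a.memLp_eval (lebesgueTo t)) (h.integral_inner_atom hM t) x
    have h2 : MemLp (stepIntegral M t x) 2 P :=
      memLp_linearCombination (fun a => h.memLp_atom_integral a t) x
    rw [eLpNorm_two_le_iff, ← eLpNorm_two_sq, ← eLpNorm_two_sq, eLpNorm_two_sq_eq_integral h2,
      eLpNorm_two_sq_eq_integral (memLp_stepEval x _), ← ENNReal.coe_pow, NNReal.sq_sqrt]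
    refine le_of_eq ?_
    unfold stepIntegral
    rw [h1, ENNReal.ofReal_mul (variance_nonneg _ _)]
    rfl

/-- Increments of integrals are orthogonal to the past. -/
theorem integral_inner_stepIntegral_sub (h : IsSquareIntegrableLevy 𝓕 P M)
    (hM : Martingale M 𝓕 P) {s t : ℝ≥0} (hst : s ≤ t) (x : Atom 𝓕 P H →₀ ℝ) {φ : Ω → H}
    (hφ : StronglyMeasurable[𝓕 s] φ) (hφ2 : MemLp φ 2 P) :
    ∫ ω, inner ℝ (stepIntegral M t x ω - stepIntegral M s x ω) (φ ω) ∂P = 0 := by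
  have h1 : ∀ ω, inner ℝ (stepIntegral M t x ω - stepIntegral M s x ω) (φ ω)
      = ∑ a ∈ x.support, x a * inner ℝ (a.integral M t ω - a.integral M s ω) (φ ω) := by
    intro ω
    simp only [stepIntegral_apply, ← Finset.sum_sub_distrib, ← smul_sub, sum_inner,
      real_inner_smul_left]
  simp_rw [h1]
  have h2 : ∀ a : Atom 𝓕 P H, MemLp (fun ω => a.integral M t ω - a.integral M s ω) 2 P :=
    fun a => (h.memLp_atom_integral a t).sub (h.memLp_atom_integral a s)
  rw [integral_finsetSum _ fun a _ => (integrable_inner_of_memLp (h2 a) hφ2).const_mul _]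
  refine Finset.sum_eq_zero fun a _ => ?_
  rw [integral_const_mul]
  simp_rw [Atom.integral_sub_integral M hst a]
  have h3 : StronglyMeasurable[𝓕 (a.slice s t).left] φ := hφ.mono (𝓕.mono (le_max_left _ _))
  have h4 : StronglyMeasurable[𝓕 (a.slice s t).left] a.val := (a.slice s t).measurable
  rw [h.integral_inner_sub_smul_eq_zero hM (a.slice s t).le h4 h3, mul_zero]

end IsSquareIntegrableLevy

end LevyCurve

namespace LevyCurve

variable {Ω : Type*} {mΩ : MeasurableSpace Ω} {𝓕 : Filtration ℝ≥0 mΩ} {P : Measure Ω}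
  [IsProbabilityMeasure P]
  {H : Type*} [NormedAddCommGroup H] [InnerProductSpace ℝ H]

/-! ### Lebesgue measure as an integrator -/

section TimeIntegral

variable {t : ℝ≥0} {Ψ : ℝ≥0 × Ω → H}

theorem ae_integrable_section (hΨ : MemLp Ψ 2 ((lebesgueTo t).prod P)) :
    ∀ᵐ ω ∂P, Integrable (fun s => Ψ (s, ω)) (lebesgueTo t) :=
  (hΨ.integrable one_le_two).prod_left_ae

/-- Cauchy–Schwarz against the constant `1` on an interval of mass `t`. -/
theorem enorm_integral_sq_le {f : ℝ≥0 → H} (hf : Integrable f (lebesgueTo t)) :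
    ‖∫ s, f s ∂lebesgueTo t‖ₑ ^ 2 ≤ t * ∫⁻ s, ‖f s‖ₑ ^ 2 ∂lebesgueTo t := by
  have h1 := eLpNorm_le_eLpNorm_mul_rpow_measure_univ (p := 1) (q := 2) one_le_two hf.1
  rw [eLpNorm_one_eq_lintegral_enorm, lebesgueTo_univ] at h1
  have h2 : (t : ℝ≥0∞) ^ (1 / (1 : ℝ≥0∞).toReal - 1 / (2 : ℝ≥0∞).toReal)
      = (t : ℝ≥0∞) ^ (1 / 2 : ℝ) := by
    norm_num
  rw [h2] at h1
  calc ‖∫ s, f s ∂lebesgueTo t‖ₑ ^ 2 ≤ (eLpNorm f 2 (lebesgueTo t) * (t : ℝ≥0∞) ^ (1 / 2 : ℝ)) ^ 2 := by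
        gcongr
        exact (enorm_integral_le_lintegral_enorm _).trans h1
    _ = t * ∫⁻ s, ‖f s‖ₑ ^ 2 ∂lebesgueTo t := by
        rw [mul_pow, eLpNorm_two_sq, ← ENNReal.rpow_natCast, ← ENNReal.rpow_mul, mul_comm]
        norm_num

theorem lintegral_enorm_integral_sq_le (hΨ : MemLp Ψ 2 ((lebesgueTo t).prod P)) :
    ∫⁻ ω, ‖∫ s, Ψ (s, ω) ∂lebesgueTo t‖ₑ ^ 2 ∂P
      ≤ t * ∫⁻ p, ‖Ψ p‖ₑ ^ 2 ∂(lebesgueTo t).prod P := by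
  rw [lintegral_prod_symm _ (hΨ.1.enorm.pow_const 2), ← lintegral_const_mul' _ _ ENNReal.coe_ne_top]
  refine lintegral_mono_ae ?_
  filter_upwards [ae_integrable_section hΨ] with ω hω using enorm_integral_sq_le hω

theorem Atom.integral_timeIntegrator [CompleteSpace H] (a : Atom 𝓕 P H) (t : ℝ≥0) (ω : Ω) :
    a.integral timeIntegrator t ω = ∫ s, a.eval (s, ω) ∂lebesgueTo t := by
  simp only [Atom.eval]
  rw [integral_indicator measurableSet_Ioc, setIntegral_const, lebesgueTo_real_Ioc, Atom.integral]
  congr 1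
  simp only [timeIntegrator]
  rcases le_total a.left t with h1 | h1
  · rw [min_eq_left h1, max_eq_left (sub_nonneg.2 (mod_cast le_min a.le h1))]
  · rw [min_eq_right h1, min_eq_right (h1.trans a.le), max_eq_right (sub_nonpos.2 (mod_cast h1)),
      sub_self]

theorem Atom.integrable_section (a : Atom 𝓕 P H) (t : ℝ≥0) (ω : Ω) :
    Integrable (fun s => a.eval (s, ω)) (lebesgueTo t) :=
  (integrable_const (a.val ω)).indicator measurableSet_Ioc

theorem integrable_section_stepEval (x : Atom 𝓕 P H →₀ ℝ) (t : ℝ≥0) (ω : Ω) :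
    Integrable (fun s => stepEval x (s, ω)) (lebesgueTo t) := by
  simp_rw [stepEval_apply]
  exact integrable_finsetSum _ fun a _ => (a.integrable_section t ω).smul (x a)

theorem stepIntegral_timeIntegrator [CompleteSpace H] (x : Atom 𝓕 P H →₀ ℝ) (t : ℝ≥0) (ω : Ω) :
    stepIntegral timeIntegrator t x ω = ∫ s, stepEval x (s, ω) ∂lebesgueTo t := by
  simp_rw [stepEval_apply, stepIntegral_apply]
  rw [integral_finsetSum _ fun a _ => (a.integrable_section t ω).smul (x a)]
  refine Finset.sum_congr rfl fun a _ => ?_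
  rw [integral_smul, Atom.integral_timeIntegrator]

theorem isL2Integrator_timeIntegrator [CompleteSpace H] (T : ℝ≥0) :
    IsL2Integrator 𝓕 P H timeIntegrator T (NNReal.sqrt T) where
  adapted t := stronglyMeasurable_const
  memLp a t := a.memLp.const_smul (((min a.right t : ℝ≥0) : ℝ) - (min a.left t : ℝ≥0))
  bound t ht x := by
    rw [eLpNorm_two_le_iff, ← ENNReal.coe_pow, NNReal.sq_sqrt]
    rw [show stepIntegral timeIntegrator t x = fun ω => ∫ s, stepEval x (s, ω) ∂lebesgueTo t from
      funext fun ω => stepIntegral_timeIntegrator x t ω]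
    refine (lintegral_enorm_integral_sq_le (memLp_stepEval x _)).trans ?_
    gcongr

end TimeIntegral

/-! ### Extension of the integral by continuity -/

section Extension

variable {A : ℝ≥0 → Ω → ℝ} {T C : ℝ≥0} {Φp : ℝ≥0 × Ω → H}

/-- The curve `G` in `L²(Ω;H)` extends the step integrals against `A` to the integrand `Φp`. -/
def ExtendsStepIntegral (𝓕 : Filtration ℝ≥0 mΩ) (A : ℝ≥0 → Ω → ℝ) (C : ℝ≥0) (Φp : ℝ≥0 × Ω → H)
    (G : Set.Icc (0 : ℝ≥0) T → Lp H 2 P) : Prop :=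
  ∀ (t : Set.Icc (0 : ℝ≥0) T) (x : Atom 𝓕 P H →₀ ℝ),
    eLpNorm (fun ω => stepIntegral A t x ω - G t ω) 2 P
      ≤ C * eLpNorm (fun p => stepEval x p - Φp p) 2 ((lebesgueTo t).prod P)

theorem eLpNorm_lebesgueTo_mono {s t : ℝ≥0} (hst : s ≤ t) (f : ℝ≥0 × Ω → H) :
    eLpNorm f 2 ((lebesgueTo s).prod P) ≤ eLpNorm f 2 ((lebesgueTo t).prod P) :=
  eLpNorm_mono_measure _ (Measure.prod_mono (lebesgueTo_mono hst) le_rfl)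

/-- Integrals of approximations with errors `2⁻ᵏ` form a Cauchy sequence. The estimate for an
arbitrary step process `y` is the limit, as `k → ∞`, of the bound applied to `y - x k`. -/
theorem IsL2Integrator.exists_extends [CompleteSpace H] (h : IsL2Integrator 𝓕 P H A T C)
    (hm : AEStronglyMeasurable Φp ((lebesgueTo T).prod P))
    (happ : ∀ ε : ℝ≥0∞, ε ≠ 0 → ∃ x : Atom 𝓕 P H →₀ ℝ,
      eLpNorm (fun p => stepEval x p - Φp p) 2 ((lebesgueTo T).prod P) ≤ ε) :
    ∃ G : Set.Icc (0 : ℝ≥0) T → Lp H 2 P, ExtendsStepIntegral 𝓕 A C Φp G := by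
  have hε : ∀ k : ℕ, ((1 : ℝ≥0∞) / 2 ^ k) ≠ 0 := fun k => by
    simp
  choose x hx using fun k : ℕ => happ _ (hε k)
  have hJ : ∀ (t : Set.Icc (0 : ℝ≥0) T) (y z : Atom 𝓕 P H →₀ ℝ),
      eLpNorm (fun ω => stepIntegral A t y ω - stepIntegral A t z ω) 2 P
      ≤ C * (eLpNorm (fun p => stepEval y p - Φp p) 2 ((lebesgueTo t).prod P)
        + eLpNorm (fun p => stepEval z p - Φp p) 2 ((lebesgueTo t).prod P)) := by
    intro t y z
    have h1 := h.bound t t.2.2 (y - z)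
    rw [map_sub, map_sub] at h1
    refine h1.trans ?_
    gcongr
    have hle : (lebesgueTo t).prod P ≪ (lebesgueTo T).prod P :=
      Measure.absolutelyContinuous_of_le (Measure.prod_mono (lebesgueTo_mono t.2.2) le_rfl)
    have hmt : AEStronglyMeasurable Φp ((lebesgueTo t).prod P) := hm.mono_ac hle
    have h2 : stepEval y - stepEval z
        = (fun p => stepEval y p - Φp p) - (fun p => stepEval z p - Φp p) := by
      ext p; simp
    rw [h2]
    exact eLpNorm_sub_le ((memLp_stepEval y _).1.sub hmt) ((memLp_stepEval z _).1.sub hmt)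
      one_le_two
  have hlim : ∀ t : Set.Icc (0 : ℝ≥0) T, ∃ g : Lp H 2 P,
      Tendsto (fun k => (h.memLp_stepIntegral (x k) t).toLp) atTop (𝓝 g) := by
    intro t
    refine cauchySeq_tendsto_of_complete ?_
    -- The factor `2` covers the errors of two consecutive approximations, each at most `2⁻ᵏ`.
    refine cauchySeq_of_edist_le_geometric_two (C * 2) (by finiteness) fun k => ?_
    rw [Lp.edist_toLp_toLp]
    refine (hJ t (x k) (x (k + 1))).trans ?_
    rw [mul_div_assoc]
    gcongr
    rw [show (2 : ℝ≥0∞) = 1 + 1 by norm_num, ENNReal.add_div, one_add_one_eq_two]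
    refine add_le_add ((eLpNorm_lebesgueTo_mono t.2.2 _).trans (hx k))
      ((eLpNorm_lebesgueTo_mono t.2.2 _).trans ((hx (k + 1)).trans ?_))
    gcongr
    · exact one_le_two
    · exact k.le_succ
  choose G hG using hlim
  refine ⟨G, fun t y => ?_⟩
  have h1 : Tendsto (fun k => edist ((h.memLp_stepIntegral y t).toLp)
      ((h.memLp_stepIntegral (x k) t).toLp)) atTop
      (𝓝 (edist ((h.memLp_stepIntegral y t).toLp) (G t))) := tendsto_const_nhds.edist (hG t)
  have h2 : edist ((h.memLp_stepIntegral y t).toLp) (G t)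
      = eLpNorm (fun ω => stepIntegral A t y ω - G t ω) 2 P := by
    rw [Lp.edist_def]
    refine eLpNorm_congr_ae ?_
    filter_upwards [(h.memLp_stepIntegral y t).coeFn_toLp] with ω hω
    rw [Pi.sub_apply, hω]
  rw [← h2]
  have h3 : Tendsto (fun k : ℕ => (C : ℝ≥0∞) *
      (eLpNorm (fun p => stepEval y p - Φp p) 2 ((lebesgueTo t).prod P) + 1 / 2 ^ k)) atTop
      (𝓝 (C * (eLpNorm (fun p => stepEval y p - Φp p) 2 ((lebesgueTo t).prod P) + 0))) := by
    refine ENNReal.Tendsto.const_mul (tendsto_const_nhds.add ?_) (Or.inr ENNReal.coe_ne_top)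
    simp [ENNReal.inv_pow]
  rw [add_zero] at h3
  refine le_of_tendsto_of_tendsto' h1 h3 fun k => ?_
  rw [Lp.edist_toLp_toLp]
  refine (hJ t y (x k)).trans ?_
  gcongr
  exact (eLpNorm_lebesgueTo_mono t.2.2 _).trans (hx k)

/-- Here the extension is explicit: the Cauchy–Schwarz estimate applied to `stepEval x - Φp` shows
that the pathwise Bochner integral satisfies the defining bound. -/
theorem extendsStepIntegral_timeIntegrator [CompleteSpace H]
    (hm : MemLp Φp 2 ((lebesgueTo T).prod P)) :
    ∃ G : Set.Icc (0 : ℝ≥0) T → Lp H 2 P,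
      ExtendsStepIntegral 𝓕 timeIntegrator (NNReal.sqrt T) Φp G ∧
      ∀ t, G t =ᵐ[P] fun ω => ∫ s, Φp (s, ω) ∂lebesgueTo t := by
  have hmt : ∀ t : Set.Icc (0 : ℝ≥0) T, MemLp Φp 2 ((lebesgueTo t).prod P) := fun t =>
    hm.mono_measure (Measure.prod_mono (lebesgueTo_mono t.2.2) le_rfl)
  have hmem : ∀ t : Set.Icc (0 : ℝ≥0) T, MemLp (fun ω => ∫ s, Φp (s, ω) ∂lebesgueTo t) 2 P := by
    intro t
    refine ⟨((hmt t).1.prod_swap).integral_prod_right', ?_⟩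
    have h1 := lintegral_enorm_integral_sq_le (hmt t)
    rw [← eLpNorm_two_sq, ← eLpNorm_two_sq] at h1
    by_contra hc
    rw [not_lt, top_le_iff] at hc
    rw [hc] at h1
    have : (t : ℝ≥0∞) * eLpNorm Φp 2 ((lebesgueTo t).prod P) ^ 2 ≠ ∞ :=
      ENNReal.mul_ne_top ENNReal.coe_ne_top (ENNReal.pow_ne_top (hmt t).2.ne)
    simp at h1
    exact this h1
  refine ⟨fun t => (hmem t).toLp, fun t x => ?_, fun t => (hmem t).coeFn_toLp⟩
  rw [eLpNorm_two_le_iff, ← ENNReal.coe_pow, NNReal.sq_sqrt]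
  have h1 : ∫⁻ ω, ‖stepIntegral timeIntegrator t x ω - (hmem t).toLp _ ω‖ₑ ^ 2 ∂P
      = ∫⁻ ω, ‖∫ s, (stepEval x (s, ω) - Φp (s, ω)) ∂lebesgueTo t‖ₑ ^ 2 ∂P := by
    refine lintegral_congr_ae ?_
    filter_upwards [(hmem t).coeFn_toLp, ae_integrable_section (hmt t)] with ω h1 h2
    rw [h1, stepIntegral_timeIntegrator, integral_sub (integrable_section_stepEval x t ω) h2]
  rw [h1]
  refine (lintegral_enorm_integral_sq_le ((memLp_stepEval x _).sub (hmt t))).trans ?_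
  gcongr
  · exact t.2.2
  · rfl

variable {G : Set.Icc (0 : ℝ≥0) T → Lp H 2 P}

/-- The error at time `t` is controlled by the approximation error on all of `[0,T]`, which does not
depend on `t`. Continuity and adaptedness of `G` follow, since both survive this limit. -/
theorem ExtendsStepIntegral.exists_tendstoUniformly (hG : ExtendsStepIntegral 𝓕 A C Φp G)
    (h : IsL2Integrator 𝓕 P H A T C)
    (happ : ∀ ε : ℝ≥0∞, ε ≠ 0 → ∃ x : Atom 𝓕 P H →₀ ℝ,
      eLpNorm (fun p => stepEval x p - Φp p) 2 ((lebesgueTo T).prod P) ≤ ε) :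
    ∃ x : ℕ → Atom 𝓕 P H →₀ ℝ, TendstoUniformly (fun k (t : Set.Icc (0 : ℝ≥0) T) =>
      (h.memLp_stepIntegral (x k) t).toLp) G atTop := by
  have hε : ∀ k : ℕ, ((1 : ℝ≥0∞) / (k + 1)) ≠ 0 := fun k => by
    simp
  choose x hx using fun k : ℕ => happ _ (hε k)
  refine ⟨x, ?_⟩
  rw [EMetric.tendstoUniformly_iff]
  intro ε hε0
  have h3 : Tendsto (fun k : ℕ => (C : ℝ≥0∞) * (1 / (k + 1))) atTop (𝓝 (C * 0)) := by
    refine ENNReal.Tendsto.const_mul ?_ (Or.inr ENNReal.coe_ne_top)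
    have := (ENNReal.tendsto_inv_nat_nhds_zero).comp (tendsto_add_atTop_nat 1)
    simpa [Function.comp_def] using this
  rw [mul_zero] at h3
  filter_upwards [h3.eventually (gt_mem_nhds hε0)] with k hk t
  rw [edist_comm]
  refine lt_of_le_of_lt ?_ hk
  rw [Lp.edist_def]
  refine le_trans (le_of_eq (eLpNorm_congr_ae ?_)) ((hG t (x k)).trans ?_)
  · filter_upwards [(h.memLp_stepIntegral (x k) t).coeFn_toLp] with ω hω
    rw [Pi.sub_apply, hω]
  · gcongr
    exact (eLpNorm_lebesgueTo_mono t.2.2 _).trans (hx k)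

theorem ExtendsStepIntegral.continuous (hG : ExtendsStepIntegral 𝓕 A C Φp G)
    (h : IsL2Integrator 𝓕 P H A T C)
    (happ : ∀ ε : ℝ≥0∞, ε ≠ 0 → ∃ x : Atom 𝓕 P H →₀ ℝ,
      eLpNorm (fun p => stepEval x p - Φp p) 2 ((lebesgueTo T).prod P) ≤ ε) :
    Continuous G := by
  obtain ⟨x, hunif⟩ := hG.exists_tendstoUniformly h happ
  refine hunif.continuous (Frequently.of_forall fun k => ?_)
  rw [continuous_iff_continuousAt]
  intro s
  rw [ContinuousAt, tendsto_iff_edist_tendsto_0]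
  simp_rw [Lp.edist_toLp_toLp]
  exact h.tendsto_eLpNorm_stepIntegral_sub (x k) s

theorem ExtendsStepIntegral.mem_lpMeas [CompleteSpace H] (hG : ExtendsStepIntegral 𝓕 A C Φp G)
    (h : IsL2Integrator 𝓕 P H A T C)
    (happ : ∀ ε : ℝ≥0∞, ε ≠ 0 → ∃ x : Atom 𝓕 P H →₀ ℝ,
      eLpNorm (fun p => stepEval x p - Φp p) 2 ((lebesgueTo T).prod P) ≤ ε)
    (t : Set.Icc (0 : ℝ≥0) T) : G t ∈ lpMeas H ℝ (𝓕 t) 2 P := by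
  obtain ⟨x, hunif⟩ := hG.exists_tendstoUniformly h happ
  have hcl : IsClosed {f : Lp H 2 P | AEStronglyMeasurable[𝓕 t] f P} :=
    isClosed_aestronglyMeasurable (𝓕.le t)
  rw [mem_lpMeas_iff_aestronglyMeasurable]
  refine hcl.mem_of_tendsto (hunif.tendsto_at t) (Eventually.of_forall fun k => ?_)
  exact ⟨_, h.stronglyMeasurable_stepIntegral (x k) t, (h.memLp_stepIntegral (x k) t).coeFn_toLp⟩

end Extension

end LevyCurve

/-! ### Partitions and processes constant between partition times -/

namespace LevyCurve

theorem exists_mem_Ioc_of_fin {n : ℕ} (τ : Fin (n + 1) → ℝ≥0) {s : ℝ≥0} (h0 : τ 0 < s)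
    (h1 : s ≤ τ (Fin.last n)) : ∃ i : Fin n, s ∈ Set.Ioc (τ i.castSucc) (τ i.succ) := by
  induction n with
  | zero => exact absurd h1 (not_le.2 h0)
  | succ n ih =>
    by_cases hs : s ≤ τ (Fin.last n).castSucc
    · obtain ⟨i, hi⟩ := ih (fun i => τ i.castSucc) h0 hs
      exact ⟨i.castSucc, hi⟩
    · exact ⟨Fin.last n, not_le.1 hs, h1⟩

theorem notMem_Ioc_of_ne {n : ℕ} {τ : Fin (n + 1) → ℝ≥0} (hτ : Monotone τ) {s : ℝ≥0} {i j : Fin n}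
    (hi : s ∈ Set.Ioc (τ i.castSucc) (τ i.succ)) (hij : j ≠ i) :
    s ∉ Set.Ioc (τ j.castSucc) (τ j.succ) := by
  intro hj
  rcases lt_or_gt_of_ne hij with h | h
  · exact absurd (hj.2.trans (hτ (Fin.succ_le_castSucc_iff.2 h))) (not_le.2 hi.1)
  · exact absurd (hi.2.trans (hτ (Fin.succ_le_castSucc_iff.2 h))) (not_le.2 hj.1)

theorem sum_indicator_Ioc {n : ℕ} {τ : Fin (n + 1) → ℝ≥0} (hτ : Monotone τ) {s : ℝ≥0} {i : Fin n}
    (hi : s ∈ Set.Ioc (τ i.castSucc) (τ i.succ)) {E : Type*} [AddCommMonoid E] (v : Fin n → E) :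
    ∑ j : Fin n, (Set.Ioc (τ j.castSucc) (τ j.succ)).indicator (fun _ => v j) s = v i := by
  rw [Finset.sum_eq_single i (fun j _ hj => Set.indicator_of_notMem (notMem_Ioc_of_ne hτ hi hj) _)
    (fun h => absurd (Finset.mem_univ i) h), Set.indicator_of_mem hi]

/-- Partitions of `[0,t]` of arbitrarily small mesh. -/
theorem exists_partition {T : ℝ≥0} (t : Set.Icc (0 : ℝ≥0) T) {δ : ℝ} (hδ : 0 < δ) :
    ∃ (n : ℕ) (τ : Fin (n + 1) → Set.Icc (0 : ℝ≥0) T), StrictMono τ ∧ (τ 0 : ℝ≥0) = 0 ∧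
      τ (Fin.last n) = t ∧
      ∀ i : Fin n, ((τ i.succ : ℝ≥0) : ℝ) - ((τ i.castSucc : ℝ≥0) : ℝ) < δ := by
  -- Strictly increasing times from `0` to `0` form a single point, so `n = 0`; for `t > 0`
  -- equidistant times are used, with `n > t / δ`.
  rcases eq_or_ne (t : ℝ≥0) 0 with ht | ht
  · refine ⟨0, fun _ => t, ?_, ht, rfl, fun i => i.elim0⟩
    intro i j hij
    exact absurd hij (by rw [Fin.fin_one_eq_zero i, Fin.fin_one_eq_zero j]; exact lt_irrefl _)
  · have ht0 : (0 : ℝ≥0) < t := pos_iff_ne_zero.2 ht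
    obtain ⟨m, hm⟩ := exists_nat_gt (((t : ℝ≥0) : ℝ) / δ)
    let n := m + 1
    have hn : (0 : ℝ≥0) < n := by positivity
    refine ⟨n, fun i => ⟨t * ((i : ℕ) : ℝ≥0) / n, zero_le, ?_⟩, ?_, ?_, ?_, ?_⟩
    · refine le_trans ?_ t.2.2
      rw [div_le_iff₀ hn]
      gcongr
      exact_mod_cast i.is_le
    · intro i j hij
      change (t : ℝ≥0) * ((i : ℕ) : ℝ≥0) / n < t * ((j : ℕ) : ℝ≥0) / n
      gcongr
      exact hij
    · simp
    · ext
      simp [hn.ne']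
    · intro i
      simp only [Fin.val_succ, Fin.val_castSucc]
      push_cast
      have hn' : (0 : ℝ) < n := by positivity
      rw [← sub_div, div_lt_iff₀ hn']
      have : ((t : ℝ≥0) : ℝ) < m * δ := by rwa [div_lt_iff₀ hδ] at hm
      have hmn : (n : ℝ) = m + 1 := by simp [n]
      rw [hmn]
      nlinarith

section

variable {Ω : Type*} {mΩ : MeasurableSpace Ω} {𝓕 : Filtration ℝ≥0 mΩ} {P : Measure Ω}
  [IsProbabilityMeasure P]
  {H : Type*} [NormedAddCommGroup H] [InnerProductSpace ℝ H]

/-- The step process with values `ψ i` between consecutive times `τ`. -/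
noncomputable def stepOf {n : ℕ} {τ : Fin (n + 1) → ℝ≥0} (hτ : Monotone τ) {ψ : Fin n → Ω → H}
    (hψ : ∀ i : Fin n, StronglyMeasurable[𝓕 (τ i.castSucc)] (ψ i)) (hψ2 : ∀ i, MemLp (ψ i) 2 P) :
    Atom 𝓕 P H →₀ ℝ :=
  ∑ i : Fin n, Finsupp.single ⟨τ i.castSucc, τ i.succ, hτ i.castSucc_le_succ, ψ i, hψ i, hψ2 i⟩ 1

section

variable {n : ℕ} {τ : Fin (n + 1) → ℝ≥0} (hτ : Monotone τ) {ψ : Fin n → Ω → H}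
    (hψ : ∀ i : Fin n, StronglyMeasurable[𝓕 (τ i.castSucc)] (ψ i)) (hψ2 : ∀ i, MemLp (ψ i) 2 P)

theorem stepEval_stepOf (p : ℝ≥0 × Ω) : stepEval (stepOf hτ hψ hψ2) p
    = ∑ i : Fin n, (Set.Ioc (τ i.castSucc) (τ i.succ)).indicator (fun _ => ψ i p.2) p.1 := by
  rw [stepOf, map_sum, Finset.sum_apply]
  refine Finset.sum_congr rfl fun i _ => ?_
  rw [stepEval_single_one]
  rfl

theorem stepIntegral_stepOf (A : ℝ≥0 → Ω → ℝ) (t : ℝ≥0) (ω : Ω) :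
    stepIntegral A t (stepOf hτ hψ hψ2) ω
    = ∑ i : Fin n, (A (min (τ i.succ) t) ω - A (min (τ i.castSucc) t) ω) • ψ i ω := by
  rw [stepOf, map_sum, Finset.sum_apply]
  refine Finset.sum_congr rfl fun i _ => ?_
  rw [stepIntegral_single_one]
  rfl

theorem lintegral_stepEval_stepOf_sub_le {Φp : ℝ≥0 × Ω → H} {t : ℝ≥0}
    (hm : AEStronglyMeasurable Φp ((lebesgueTo t).prod P)) (h0 : τ 0 = 0)
    (h1 : τ (Fin.last n) = t) {c : ℝ≥0∞}
    (hc : ∀ i : Fin n, ∀ s ∈ Set.Ioc (τ i.castSucc) (τ i.succ),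
      ∫⁻ ω, ‖ψ i ω - Φp (s, ω)‖ₑ ^ 2 ∂P ≤ c) :
    ∫⁻ p, ‖stepEval (stepOf hτ hψ hψ2) p - Φp p‖ₑ ^ 2 ∂(lebesgueTo t).prod P ≤ c * t := by
  have hm' : AEStronglyMeasurable (fun p => stepEval (stepOf hτ hψ hψ2) p - Φp p)
    ((lebesgueTo t).prod P) := (memLp_stepEval _ _).1.sub hm
  rw [lintegral_prod _ (hm'.enorm.pow_const 2)]
  calc _ ≤ ∫⁻ _, c ∂lebesgueTo t := by
        refine lintegral_mono_ae ?_
        -- The half-open intervals cover `(0,t]`; the missing time `0` is Lebesgue-null.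
        filter_upwards [ae_lebesgueTo_ne t 0, ae_mem_lebesgueTo t] with s hs0 hst
        obtain ⟨i, hi⟩ := exists_mem_Ioc_of_fin τ (s := s) (h0 ▸ pos_iff_ne_zero.2 hs0) (h1 ▸ hst)
        simp_rw [stepEval_stepOf, sum_indicator_Ioc hτ hi]
        exact hc i s hi
    _ = c * t := by rw [lintegral_const, lebesgueTo_univ]

end

theorem ElementaryProcess.memLp_val (Ψ : ElementaryProcess 𝓕 H) (i : Fin Ψ.n) :
    MemLp (Ψ.val i) 2 P := by
  obtain ⟨C, hC⟩ := Ψ.bounded i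
  exact MemLp.of_bound ((Ψ.measurable i).mono (𝓕.le _)).aestronglyMeasurable C (ae_of_all _ hC)

variable (P) in
/-- An elementary process as a formal linear combination of atoms. -/
noncomputable def ElementaryProcess.toStep (Ψ : ElementaryProcess 𝓕 H) : Atom 𝓕 P H →₀ ℝ :=
  stepOf Ψ.mono Ψ.measurable Ψ.memLp_val

theorem ElementaryProcess.stepEval_toStep (Ψ : ElementaryProcess 𝓕 H) (p : ℝ≥0 × Ω) :
    stepEval (Ψ.toStep P) p = Ψ.eval p.1 p.2 := stepEval_stepOf _ _ _ _

theorem ElementaryProcess.stepIntegral_toStep (Ψ : ElementaryProcess 𝓕 H) (A : ℝ≥0 → Ω → ℝ)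
    (t : ℝ≥0) (ω : Ω) : stepIntegral A t (Ψ.toStep P) ω = Ψ.integral A t ω :=
  stepIntegral_stepOf _ _ _ _ _ _

theorem predictable_le : 𝓕.predictable ≤ (inferInstance : MeasurableSpace (ℝ≥0 × Ω)) := by
  refine measurableSpace_le_predictable_of_measurableSet (fun A hA => ?_) fun i A hA => ?_
  · exact (measurableSet_singleton _).prod (𝓕.le _ _ hA)
  · exact measurableSet_Ioi.prod (𝓕.le _ _ hA)

/-! ### Left-point approximation of curves and the (G-) integral -/

section Curve

variable [CompleteSpace H] [SecondCountableTopology H] {T : ℝ≥0} (Φ : Cad 𝓕 P H T)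

theorem stronglyMeasurable_curve (h𝓕 : UsualConditions 𝓕 P) (t : Set.Icc (0 : ℝ≥0) T) :
    StronglyMeasurable[𝓕 t] (Φ.1 t : Ω → H) :=
  h𝓕.stronglyMeasurable_of_mem_lpMeas (Φ.2 t) EventuallyEq.rfl

/-- Heine–Cantor: the curve is continuous on a compact interval. -/
theorem exists_modulus {η : ℝ} (hη : 0 < η) : ∃ δ : ℝ, 0 < δ ∧ ∀ s t : Set.Icc (0 : ℝ≥0) T,
    |((s : ℝ≥0) : ℝ) - (t : ℝ≥0)| < δ →
      ∫⁻ ω, ‖(Φ.1 s : Ω → H) ω - (Φ.1 t : Ω → H) ω‖ₑ ^ 2 ∂P ≤ ENNReal.ofReal (η ^ 2) := by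
  have hu : UniformContinuous Φ.1 := CompactSpace.uniformContinuous_of_continuous Φ.1.continuous
  obtain ⟨δ, hδ, h⟩ := Metric.uniformContinuous_iff.1 hu η hη
  refine ⟨δ, hδ, fun s t hst => ?_⟩
  have h1 := h (a := s) (b := t) (by rwa [Subtype.dist_eq, NNReal.dist_eq])
  have h2 : eLpNorm (fun ω => (Φ.1 s : Ω → H) ω - (Φ.1 t : Ω → H) ω) 2 P ≤ ENNReal.ofReal η := by
    have : edist (Φ.1 s) (Φ.1 t) ≤ ENNReal.ofReal η := by
      rw [edist_dist]; exact ENNReal.ofReal_le_ofReal h1.le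
    rwa [Lp.edist_def] at this
  rw [← eLpNorm_two_sq, ENNReal.ofReal_pow hη.le]
  gcongr

variable {Φ} {Φp : ℝ≥0 → Ω → H}

theorem IsPredictableVersion.stronglyMeasurable (hΦp : IsPredictableVersion Φ Φp) :
    StronglyMeasurable (Function.uncurry Φp) :=
  StronglyMeasurable.mono hΦp.predictable predictable_le

/-- At every time the L² norm of the section is at most the supremum norm of the curve, so Tonelli
bounds the squared norm by `‖Φ‖² T`. -/
theorem IsPredictableVersion.isL2Predictable (hΦp : IsPredictableVersion Φ Φp) :
    IsL2Predictable 𝓕 P T Φp := by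
  refine ⟨hΦp.predictable, hΦp.stronglyMeasurable.aestronglyMeasurable, ?_⟩
  have h1 : eLpNorm (Function.uncurry Φp) 2 ((lebesgueTo T).prod P) ^ 2
      ≤ ENNReal.ofReal ‖Φ.1‖ ^ 2 * T := by
    rw [eLpNorm_two_sq, lintegral_prod _
      (hΦp.stronglyMeasurable.aestronglyMeasurable.enorm.pow_const 2)]
    calc _ ≤ ∫⁻ _, ENNReal.ofReal ‖Φ.1‖ ^ 2 ∂lebesgueTo T := by
          refine lintegral_mono_ae ?_
          filter_upwards [ae_mem_lebesgueTo T] with s hsT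
          have h2 := hΦp.version ⟨s, zero_le, hsT⟩
          have h3 : ∫⁻ ω, ‖Function.uncurry Φp (s, ω)‖ₑ ^ 2 ∂P
              = eLpNorm (Φ.1 ⟨s, zero_le, hsT⟩ : Ω → H) 2 P ^ 2 := by
            rw [eLpNorm_two_sq]
            refine lintegral_congr_ae ?_
            filter_upwards [h2] with ω hω
            rw [← hω]; rfl
          rw [h3]
          gcongr
          rw [← Lp.enorm_def, ← ofReal_norm]
          exact ENNReal.ofReal_le_ofReal (Φ.1.norm_coe_le_norm _)
      _ = _ := by rw [lintegral_const, lebesgueTo_univ]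
  by_contra hc
  rw [not_lt, top_le_iff] at hc
  change eLpNorm (Function.uncurry Φp) 2 ((lebesgueTo T).prod P) = ∞ at hc
  rw [hc] at h1
  have : ENNReal.ofReal ‖Φ.1‖ ^ 2 * T ≠ ∞ := by finiteness
  rw [ENNReal.top_pow two_ne_zero, top_le_iff] at h1
  exact this h1

/-- Left-point approximations of a curve along a partition of `[0,t]`. -/
theorem exists_step_of_partition (h𝓕 : UsualConditions 𝓕 P) (hΦp : IsPredictableVersion Φ Φp)
    {η δ : ℝ} (hmod : ∀ s t : Set.Icc (0 : ℝ≥0) T, |((s : ℝ≥0) : ℝ) - (t : ℝ≥0)| < δ →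
      ∫⁻ ω, ‖(Φ.1 s : Ω → H) ω - (Φ.1 t : Ω → H) ω‖ₑ ^ 2 ∂P ≤ ENNReal.ofReal (η ^ 2))
    {t : Set.Icc (0 : ℝ≥0) T} {n : ℕ} {τ : Fin (n + 1) → Set.Icc (0 : ℝ≥0) T} (hτ : StrictMono τ)
    (h0 : (τ 0 : ℝ≥0) = 0) (h1 : τ (Fin.last n) = t)
    (hmesh : ∀ i : Fin n, ((τ i.succ : ℝ≥0) : ℝ) - ((τ i.castSucc : ℝ≥0) : ℝ) < δ) :
    ∃ x : Atom 𝓕 P H →₀ ℝ,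
      ∫⁻ p, ‖stepEval x p - Function.uncurry Φp p‖ₑ ^ 2 ∂(lebesgueTo t).prod P
        ≤ ENNReal.ofReal (η ^ 2) * (t : ℝ≥0) ∧
      ∀ A ω, stepIntegral A t x ω = leftSum A Φ τ ω := by
  have hτ' : Monotone fun i => (τ i : ℝ≥0) := fun i j hij => hτ.monotone hij
  refine ⟨stepOf (τ := fun i => (τ i : ℝ≥0)) hτ'
    (ψ := fun i => (Φ.1 (τ i.castSucc) : Ω → H))
    (fun i => stronglyMeasurable_curve Φ h𝓕 (τ i.castSucc)) (fun i => Lp.memLp _), ?_, ?_⟩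
  · refine lintegral_stepEval_stepOf_sub_le _ _ _
      hΦp.stronglyMeasurable.aestronglyMeasurable h0 (by rw [h1]) fun i s hs => ?_
    have hsT : s ≤ T := hs.2.trans (τ i.succ).2.2
    refine le_trans (le_of_eq (lintegral_congr_ae ?_))
      (hmod (τ i.castSucc) ⟨s, zero_le, hsT⟩ ?_)
    · filter_upwards [hΦp.version ⟨s, zero_le, hsT⟩] with ω hω
      rw [← hω]; rfl
    · have h2 : ((τ i.castSucc : ℝ≥0) : ℝ) < s := mod_cast hs.1
      have h3 : (s : ℝ) ≤ ((τ i.succ : ℝ≥0) : ℝ) := mod_cast hs.2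
      rw [abs_sub_comm, abs_of_pos (sub_pos.2 h2)]
      linarith [hmesh i]
  · intro A ω
    have hle : ∀ i, (τ i : ℝ≥0) ≤ t := fun i => by
      have := hτ' (Fin.le_last i)
      simpa [h1] using this
    rw [stepIntegral_stepOf]
    simp only [leftSum, min_eq_left (hle _)]

/-- The left sum is the integral of the left-point step process, so the extension bound turns
uniform closeness of integrands into closeness of integrals. -/
theorem ExtendsStepIntegral.isGIntegralAt (h𝓕 : UsualConditions 𝓕 P)
    (hΦp : IsPredictableVersion Φ Φp) {A : ℝ≥0 → Ω → ℝ} {C : ℝ≥0}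
    {G : Set.Icc (0 : ℝ≥0) T → Lp H 2 P}
    (hG : ExtendsStepIntegral 𝓕 A C (Function.uncurry Φp) G) (t : Set.Icc (0 : ℝ≥0) T) :
    IsGIntegralAt A Φ t (G t) := by
  intro ε hε
  have hden : (0 : ℝ) < (C : ℝ) ^ 2 * T + 1 := by positivity
  -- The choice `η² = ε / (C² T + 1)` gives `C² η² T < ε`; the `1` excludes division by zero and
  -- makes the inequality strict.
  obtain ⟨δ, hδ, hmod⟩ := exists_modulus Φ (Real.sqrt_pos.2 (div_pos hε hden))
  refine ⟨δ, hδ, fun n τ hτ h0 h1 hmesh => ?_⟩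
  obtain ⟨x, hx, hxs⟩ := exists_step_of_partition h𝓕 hΦp hmod hτ h0 h1 hmesh
  have h2 := hG t x
  rw [eLpNorm_two_le_iff] at h2
  calc ∫⁻ ω, ‖(G t : Ω → H) ω - leftSum A Φ τ ω‖ₑ ^ 2 ∂P
      = ∫⁻ ω, ‖stepIntegral A t x ω - (G t : Ω → H) ω‖ₑ ^ 2 ∂P := by
        refine lintegral_congr fun ω => ?_
        rw [hxs, ← enorm_neg, neg_sub]
    _ ≤ (C : ℝ≥0∞) ^ 2 * (ENNReal.ofReal (√(ε / (C ^ 2 * T + 1)) ^ 2) * (t : ℝ≥0)) := by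
        refine h2.trans ?_
        gcongr
    _ ≤ (C : ℝ≥0∞) ^ 2 * (ENNReal.ofReal (ε / (C ^ 2 * T + 1)) * T) := by
        rw [Real.sq_sqrt (by positivity)]
        gcongr
        exact t.2.2
    _ = ENNReal.ofReal (C ^ 2 * (ε / (C ^ 2 * T + 1) * T)) := by
        rw [ENNReal.ofReal_mul (by positivity), ENNReal.ofReal_mul (by positivity),
          ENNReal.ofReal_coe_nnreal, ENNReal.ofReal_pow (by positivity), ENNReal.ofReal_coe_nnreal]
    _ < ENNReal.ofReal ε := by
        rw [ENNReal.ofReal_lt_ofReal_iff hε]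
        rw [div_mul_eq_mul_div, mul_div_assoc', div_lt_iff₀ hden]
        nlinarith

/-- Both candidates are within `ε / 2` of the same left sum, along a partition fine enough for each;
such partitions exist, so the defining condition is not vacuous. -/
theorem IsGIntegralAt.unique {A : ℝ≥0 → Ω → ℝ} {t : Set.Icc (0 : ℝ≥0) T}
    {Y Z : Lp H 2 P} (hA : ∀ s, AEStronglyMeasurable (A s) P)
    (hY : IsGIntegralAt A Φ t Y) (hZ : IsGIntegralAt A Φ t Z) : Y = Z := by
  rw [← edist_eq_zero, ← nonpos_iff_eq_zero]
  refine ENNReal.le_of_forall_pos_le_add fun ε hε _ => ?_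
  have hε2 : (0 : ℝ) < (ε / 2) ^ 2 := by positivity
  obtain ⟨δ₁, hδ₁, h₁⟩ := hY _ hε2
  obtain ⟨δ₂, hδ₂, h₂⟩ := hZ _ hε2
  obtain ⟨n, τ, hτ, h0, hl, hmesh⟩ := exists_partition t (lt_min hδ₁ hδ₂)
  have e₁ := h₁ n τ hτ h0 hl fun i => (hmesh i).trans_le (min_le_left _ _)
  have e₂ := h₂ n τ hτ h0 hl fun i => (hmesh i).trans_le (min_le_right _ _)
  have hS : AEStronglyMeasurable (leftSum A Φ τ) P := by
    unfold leftSum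
    exact Finset.aestronglyMeasurable_fun_sum _ fun i _ =>
      ((hA _).sub (hA _)).smul (Lp.aestronglyMeasurable _)
  have key : ∀ W : Lp H 2 P, ∫⁻ ω, ‖(W : Ω → H) ω - leftSum A Φ τ ω‖ₑ ^ 2 ∂P
      < ENNReal.ofReal ((ε / 2) ^ 2) →
      eLpNorm (fun ω => (W : Ω → H) ω - leftSum A Φ τ ω) 2 P ≤ ENNReal.ofReal (ε / 2) := by
    intro W hW
    rw [← eLpNorm_two_sq, ENNReal.ofReal_pow (by positivity)] at hW
    exact ((ENNReal.pow_right_strictMono two_ne_zero).lt_iff_lt.1 hW).le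
  rw [Lp.edist_def]
  have hsub : (Y : Ω → H) - Z = (fun ω => (Y : Ω → H) ω - leftSum A Φ τ ω)
      - fun ω => (Z : Ω → H) ω - leftSum A Φ τ ω := by
    ext ω; simp
  rw [hsub]
  refine (eLpNorm_sub_le ((Lp.aestronglyMeasurable _).sub hS)
    ((Lp.aestronglyMeasurable _).sub hS) one_le_two).trans ?_
  refine (add_le_add (key Y e₁) (key Z e₂)).trans ?_
  rw [← ENNReal.ofReal_add (by positivity) (by positivity), add_halves, zero_add,
    ENNReal.ofReal_coe_nnreal]

end Curve

end

end LevyCurve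

/-! ### Predictable versions and elementary approximation -/

namespace LevyCurve

variable {Ω : Type*} {mΩ : MeasurableSpace Ω} {𝓕 : Filtration ℝ≥0 mΩ} {P : Measure Ω}
  {H : Type*} [NormedAddCommGroup H]

/-- By Tonelli the series of squared errors is finite almost surely, so its terms tend to zero. -/
theorem ae_tendsto_of_tsum_lintegral {f : ℕ → Ω → H} {g : Ω → H}
    (hf : ∀ k, AEStronglyMeasurable (f k) P) (hg : AEStronglyMeasurable g P)
    (h : ∑' k, ∫⁻ ω, ‖f k ω - g ω‖ₑ ^ 2 ∂P ≠ ∞) :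
    ∀ᵐ ω ∂P, Tendsto (fun k => f k ω) atTop (𝓝 (g ω)) := by
  have hm : ∀ k, AEMeasurable (fun ω => ‖f k ω - g ω‖ₑ ^ 2) P := fun k =>
    ((hf k).sub hg).enorm.pow_const 2
  rw [← lintegral_tsum hm] at h
  filter_upwards [ae_lt_top' (AEMeasurable.tsum hm) h] with ω hω
  have h1 := tendsto_zero_of_sq (ENNReal.tendsto_atTop_zero_of_tsum_ne_top hω.ne)
  rw [tendsto_iff_edist_tendsto_0]
  simpa only [edist_eq_enorm_sub] using h1

theorem ae_eq_of_tendsto_eLpNorm {f : ℕ → Ω → H} {g h : Ω → H}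
    (hf : ∀ k, AEStronglyMeasurable (f k) P) (hg : AEStronglyMeasurable g P)
    (hh : AEStronglyMeasurable h P)
    (hfg : Tendsto (fun k => eLpNorm (fun ω => f k ω - g ω) 2 P) atTop (𝓝 0))
    (hfh : Tendsto (fun k => eLpNorm (fun ω => f k ω - h ω) 2 P) atTop (𝓝 0)) : g =ᵐ[P] h := by
  have h1 : eLpNorm (g - h) 2 P ≤ 0 := by
    have h2 := hfg.add hfh
    rw [add_zero] at h2
    refine ge_of_tendsto' h2 fun k => ?_
    have h3 : g - h = (fun ω => f k ω - h ω) - fun ω => f k ω - g ω := by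
      ext ω; simp
    rw [h3, add_comm]
    exact eLpNorm_sub_le ((hf k).sub hh) ((hf k).sub hg) one_le_two
  rw [nonpos_iff_eq_zero, eLpNorm_eq_zero_iff (hg.sub hh) two_ne_zero] at h1
  filter_upwards [h1] with ω hω
  exact sub_eq_zero.1 hω

theorem stronglyMeasurable_indicator_fst [SecondCountableTopology H]
    {m : MeasurableSpace (ℝ≥0 × Ω)} {m' : MeasurableSpace Ω} {S : Set ℝ≥0}
    (hS : ∀ B, MeasurableSet[m'] B → MeasurableSet[m] (S ×ˢ B)) {ψ : Ω → H}
    (hψ : StronglyMeasurable[m'] ψ) :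
    StronglyMeasurable[m] fun p : ℝ≥0 × Ω => S.indicator (fun _ => ψ p.2) p.1 := by
  borelize H
  refine Measurable.stronglyMeasurable (mα := m) ?_
  intro B hB
  by_cases h0 : (0 : H) ∈ B
  · have : (fun p : ℝ≥0 × Ω => S.indicator (fun _ => ψ p.2) p.1) ⁻¹' B
        = (S ×ˢ (ψ ⁻¹' B)) ∪ (S ×ˢ Set.univ)ᶜ := by
      ext p
      by_cases hp : p.1 ∈ S <;> simp [hp, h0]
    rw [this]
    exact (hS _ (hψ.measurable hB)).union (hS _ MeasurableSet.univ).compl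
  · have : (fun p : ℝ≥0 × Ω => S.indicator (fun _ => ψ p.2) p.1) ⁻¹' B = S ×ˢ (ψ ⁻¹' B) := by
      ext p
      by_cases hp : p.1 ∈ S <;> simp [hp, h0]
    rw [this]
    exact hS _ (hψ.measurable hB)

variable [IsProbabilityMeasure P]

/-- Approximating with respect to the trimmed measure keeps the simple functions measurable for the
smaller σ-algebra. Elementary processes require such bounded values. -/
theorem exists_bounded_approx {m : MeasurableSpace Ω} (hm : m ≤ mΩ) {ψ : Ω → H}
    (hψ : StronglyMeasurable[m] ψ) (hψ2 : MemLp ψ 2 P) {ε : ℝ≥0∞} (hε : ε ≠ 0) :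
    ∃ g : Ω → H, StronglyMeasurable[m] g ∧ (∃ C : ℝ, ∀ ω, ‖g ω‖ ≤ C) ∧
      eLpNorm (ψ - g) 2 P ≤ ε := by
  have h1 : MemLp ψ 2 (P.trim hm) :=
    ⟨hψ.aestronglyMeasurable, by rw [eLpNorm_trim hm hψ]; exact hψ2.2⟩
  obtain ⟨g, hg, -⟩ := h1.exists_simpleFunc_eLpNorm_sub_lt (by norm_num) hε
  refine ⟨g, SimpleFunc.stronglyMeasurable g, g.exists_forall_norm_le, ?_⟩
  rw [eLpNorm_trim hm (hψ.sub (SimpleFunc.stronglyMeasurable g))] at hg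
  exact hg.le

variable [InnerProductSpace ℝ H] [CompleteSpace H] [SecondCountableTopology H] {T : ℝ≥0}
  {Φ : Cad 𝓕 P H T}

/-- Every curve in `C_ad[0,T]` has a predictable version. -/
theorem exists_isPredictableVersion (h𝓕 : UsualConditions 𝓕 P) (Φ : Cad 𝓕 P H T) :
    ∃ Φp : ℝ≥0 → Ω → H, IsPredictableVersion Φ Φp := by
  have hη : ∀ k : ℕ, (0 : ℝ) < (1 / 2) ^ k := fun k => by positivity
  choose δ hδ hmod using fun k => exists_modulus Φ (hη k)
  choose n τ hτ h0 hl hmesh using fun k => exists_partition (⟨T, zero_le, le_rfl⟩ : Set.Icc 0 T) (hδ k)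
  have hτ' : ∀ k, Monotone fun i => (τ k i : ℝ≥0) := fun k i j hij => (hτ k).monotone hij
  let z : Set.Icc (0 : ℝ≥0) T := ⟨0, le_rfl, zero_le⟩
  -- The summand at time `0` matters: a version must agree at every time, and the intervals `(s,u]`
  -- omit `0`.
  let F : ℕ → ℝ≥0 × Ω → H := fun k p =>
    ({0} : Set ℝ≥0).indicator (fun _ => (Φ.1 z : Ω → H) p.2) p.1 + ∑ i : Fin (n k),
      (Set.Ioc (τ k i.castSucc : ℝ≥0) (τ k i.succ : ℝ≥0)).indicator
        (fun _ => (Φ.1 (τ k i.castSucc) : Ω → H) p.2) p.1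
  have hF : ∀ k, StronglyMeasurable[𝓕.predictable] (F k) := by
    intro k
    refine StronglyMeasurable.add ?_ (Finset.stronglyMeasurable_fun_sum _ fun i _ => ?_)
    · exact stronglyMeasurable_indicator_fst
        (fun B hB => measurableSet_predictable_singleton_bot_prod hB)
        (stronglyMeasurable_curve Φ h𝓕 z)
    · exact stronglyMeasurable_indicator_fst
        (fun B hB => measurableSet_predictable_Ioc_prod _ _ hB)
        (stronglyMeasurable_curve Φ h𝓕 (τ k i.castSucc))
  have hFs : ∀ (t : Set.Icc (0 : ℝ≥0) T) (k : ℕ), ∃ s : Set.Icc (0 : ℝ≥0) T,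
      |((s : ℝ≥0) : ℝ) - (t : ℝ≥0)| < δ k ∧ ∀ ω, F k (t, ω) = (Φ.1 s : Ω → H) ω := by
    intro t k
    rcases eq_or_ne (t : ℝ≥0) 0 with ht | ht
    · refine ⟨z, by simpa [z, ht] using hδ k, fun ω => ?_⟩
      simp [F, ht]
    · obtain ⟨i, hi⟩ := exists_mem_Ioc_of_fin (fun i => (τ k i : ℝ≥0)) (s := t)
        (by rw [h0]; exact pos_iff_ne_zero.2 ht) (by rw [hl]; exact t.2.2)
      refine ⟨τ k i.castSucc, ?_, fun ω => ?_⟩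
      · have h2 : ((τ k i.castSucc : ℝ≥0) : ℝ) < (t : ℝ≥0) := mod_cast hi.1
        have h3 : ((t : ℝ≥0) : ℝ) ≤ ((τ k i.succ : ℝ≥0) : ℝ) := mod_cast hi.2
        rw [abs_sub_comm, abs_of_pos (sub_pos.2 h2)]
        linarith [hmesh k i]
      · have := sum_indicator_Ioc (hτ' k) hi fun j => (Φ.1 (τ k j.castSucc) : Ω → H) ω
        simp only [F]
        rw [this, Set.indicator_of_notMem (by simpa using ht), zero_add]
  -- `limUnder` is measurable even where the sequence diverges. At each fixed `t` the mean-square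
  -- errors are at most `4⁻ᵏ`, hence summable, and the limit is almost surely `Φ t`.
  refine ⟨fun s ω => limUnder atTop fun k => F k (s, ω), ?_, fun t => ?_⟩
  · let : MeasurableSpace (ℝ≥0 × Ω) := 𝓕.predictable
    exact StronglyMeasurable.limUnder hF
  · have hb : ∀ k, ∫⁻ ω, ‖F k (t, ω) - (Φ.1 t : Ω → H) ω‖ₑ ^ 2 ∂P
        ≤ ENNReal.ofReal (((1 / 2) ^ k) ^ 2) := by
      intro k
      obtain ⟨s, hs, hs'⟩ := hFs t k
      simp_rw [hs']
      exact hmod k s t hs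
    have hsum : ∑' k : ℕ, ∫⁻ ω, ‖F k (t, ω) - (Φ.1 t : Ω → H) ω‖ₑ ^ 2 ∂P ≠ ∞ := by
      refine ne_top_of_le_ne_top ?_ (ENNReal.tsum_le_tsum hb)
      have hs : Summable fun k : ℕ => (((1 : ℝ) / 2) ^ k) ^ 2 := by
        simp_rw [← pow_mul, mul_comm _ 2, pow_mul]
        exact summable_geometric_of_lt_one (by norm_num) (by norm_num)
      rw [← ENNReal.ofReal_tsum_of_nonneg (fun k => by positivity) hs]
      exact ENNReal.ofReal_ne_top
    have hmeas : ∀ k, AEStronglyMeasurable (fun ω => F k (t, ω)) P := by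
      intro k
      obtain ⟨s, -, hs'⟩ := hFs t k
      simp_rw [hs']
      exact Lp.aestronglyMeasurable _
    filter_upwards [ae_tendsto_of_tsum_lintegral hmeas (Lp.aestronglyMeasurable (Φ.1 t)) hsum]
      with ω hω using hω.limUnder_eq

/-- Elementary processes approximate a predictable version of a curve in mean square. -/
theorem IsPredictableVersion.exists_elementary (h𝓕 : UsualConditions 𝓕 P) {Φp : ℝ≥0 → Ω → H}
    (hΦp : IsPredictableVersion Φ Φp) {ε : ℝ≥0∞} (hε : ε ≠ 0) :
    ∃ Ψ : ElementaryProcess 𝓕 H, eLpNorm (fun p => stepEval (Ψ.toStep P) p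
      - Function.uncurry Φp p) 2 ((lebesgueTo T).prod P) ≤ ε := by
  obtain ⟨e, he0, heε⟩ := ENNReal.lt_iff_exists_nnreal_btwn.1 (pos_iff_ne_zero.2 hε)
  have he : (0 : ℝ) < e := mod_cast he0
  -- Two errors of this size, from bounding the values and from the modulus of continuity, add up to
  -- `e / (T + 1)`, and `(e / (T + 1))² T ≤ e²`.
  have hη : (0 : ℝ) < e / (2 * (T + 1)) := by positivity
  obtain ⟨δ, hδ, hmod⟩ := exists_modulus Φ hη
  obtain ⟨n, τ, hτ, h0, hl, hmesh⟩ := exists_partition (⟨T, zero_le, le_rfl⟩ : Set.Icc 0 T) hδ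
  have hτ' : Monotone fun i => (τ i : ℝ≥0) := fun i j hij => hτ.monotone hij
  choose g hgm hgb hg using fun i : Fin n => exists_bounded_approx (P := P)
    (𝓕.le (τ i.castSucc : ℝ≥0)) (stronglyMeasurable_curve Φ h𝓕 (τ i.castSucc)) (Lp.memLp _)
    (ENNReal.ofReal_pos.2 hη).ne'
  let Ψ : ElementaryProcess 𝓕 H := ⟨n, fun i => (τ i : ℝ≥0), hτ', g, hgm, hgb⟩
  refine ⟨Ψ, le_trans ?_ heε.le⟩
  have h1 : ∫⁻ p, ‖stepEval (Ψ.toStep P) p - Function.uncurry Φp p‖ₑ ^ 2 ∂(lebesgueTo T).prod P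
      ≤ ENNReal.ofReal (e / (T + 1)) ^ 2 * T := by
    refine lintegral_stepEval_stepOf_sub_le _ _ _
      hΦp.stronglyMeasurable.aestronglyMeasurable h0 (by change ((τ (Fin.last n) : ℝ≥0)) = T; rw [hl])
      fun i s hs => ?_
    have hsT : s ≤ T := hs.2.trans (τ i.succ).2.2
    rw [← eLpNorm_two_sq]
    gcongr
    have h2 : eLpNorm (fun ω => g i ω - (Φ.1 (τ i.castSucc) : Ω → H) ω) 2 P
        ≤ ENNReal.ofReal (e / (2 * (T + 1))) := by
      refine le_trans (le_of_eq ?_) (hg i)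
      rw [← eLpNorm_neg]
      congr 1
      ext ω
      simp
    have h3 : eLpNorm (fun ω => (Φ.1 (τ i.castSucc) : Ω → H) ω - Function.uncurry Φp (s, ω)) 2 P
        ≤ ENNReal.ofReal (e / (2 * (T + 1))) := by
      have h4 := hmod (τ i.castSucc) ⟨s, zero_le, hsT⟩ (by
        have h2 : ((τ i.castSucc : ℝ≥0) : ℝ) < s := mod_cast hs.1
        have h3 : (s : ℝ) ≤ ((τ i.succ : ℝ≥0) : ℝ) := mod_cast hs.2
        rw [abs_sub_comm, abs_of_pos (sub_pos.2 h2)]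
        linarith [hmesh i])
      rw [← eLpNorm_two_sq, ENNReal.ofReal_pow hη.le] at h4
      refine le_trans (le_of_eq (eLpNorm_congr_ae ?_))
        ((ENNReal.pow_right_strictMono two_ne_zero).le_iff_le.1 h4)
      filter_upwards [hΦp.version ⟨s, zero_le, hsT⟩] with ω hω
      rw [← hω]; rfl
    have h5 : (fun ω => g i ω - Function.uncurry Φp (s, ω))
        = (fun ω => g i ω - (Φ.1 (τ i.castSucc) : Ω → H) ω)
          + fun ω => (Φ.1 (τ i.castSucc) : Ω → H) ω - Function.uncurry Φp (s, ω) := by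
      ext ω; simp
    rw [h5]
    refine (eLpNorm_add_le ?_ ?_ one_le_two).trans ((add_le_add h2 h3).trans (le_of_eq ?_))
    · exact ((hgm i).mono (𝓕.le _)).aestronglyMeasurable.sub (Lp.aestronglyMeasurable _)
    · exact (Lp.aestronglyMeasurable _).sub
        (hΦp.stronglyMeasurable.comp_measurable measurable_prodMk_left).aestronglyMeasurable
    · rw [← ENNReal.ofReal_add hη.le hη.le]
      congr 1
      field_simp
      norm_num
  rw [← eLpNorm_two_sq] at h1
  refine (ENNReal.pow_right_strictMono two_ne_zero).le_iff_le.1 (h1.trans ?_)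
  rw [← ENNReal.ofReal_pow (by positivity), ← ENNReal.ofReal_coe_nnreal (p := T),
    ← ENNReal.ofReal_mul (by positivity), ← ENNReal.ofReal_coe_nnreal (p := e),
    ← ENNReal.ofReal_pow (by positivity)]
  refine ENNReal.ofReal_le_ofReal ?_
  rw [div_pow, div_mul_eq_mul_div, div_le_iff₀ (by positivity)]
  gcongr
  nlinarith [T.2]

end LevyCurve

/-! ### Càdlàg paths -/

namespace LevyCurve

section Cadlag

variable {ι E : Type*} [TopologicalSpace ι] [Preorder ι]

theorem isCadlag_of_continuous [TopologicalSpace E] {f : ι → E} (hf : Continuous f) :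
    IsCadlag f :=
  fun t => ⟨hf.continuousWithinAt, f t, hf.continuousWithinAt (s := Set.Iio t)⟩

theorem isCadlag_const [TopologicalSpace E] (c : E) : IsCadlag fun _ : ι => c :=
  isCadlag_of_continuous continuous_const

variable [NormedAddCommGroup E] {f g : ι → E}

theorem IsCadlag.add (hf : IsCadlag f) (hg : IsCadlag g) : IsCadlag fun t => f t + g t := fun t => by
  obtain ⟨l, hl⟩ := (hf t).2
  obtain ⟨m, hm⟩ := (hg t).2
  exact ⟨(hf t).1.add (hg t).1, l + m, hl.add hm⟩

theorem IsCadlag.sub (hf : IsCadlag f) (hg : IsCadlag g) : IsCadlag fun t => f t - g t := fun t => by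
  obtain ⟨l, hl⟩ := (hf t).2
  obtain ⟨m, hm⟩ := (hg t).2
  exact ⟨(hf t).1.sub (hg t).1, l - m, hl.sub hm⟩

theorem IsCadlag.smul_const [NormedSpace ℝ E] {a : ι → ℝ} (ha : IsCadlag a) (v : E) :
    IsCadlag fun t => a t • v := fun t => by
  obtain ⟨l, hl⟩ := (ha t).2
  exact ⟨(ha t).1.smul continuousWithinAt_const, l • v, hl.smul_const v⟩

theorem IsCadlag.const_smul [NormedSpace ℝ E] (c : ℝ) (hf : IsCadlag f) :
    IsCadlag fun t => c • f t := fun t => by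
  obtain ⟨l, hl⟩ := (hf t).2
  exact ⟨(hf t).1.const_smul c, c • l, hl.const_smul c⟩

theorem isCadlag_finsetSum {κ : Type*} (s : Finset κ) {F : κ → ι → E} (hF : ∀ k ∈ s, IsCadlag (F k)) :
    IsCadlag fun t => ∑ k ∈ s, F k t := by
  classical
  induction s using Finset.induction_on with
  | empty => simpa using isCadlag_const (0 : E)
  | insert k s hk ih =>
    simp_rw [Finset.sum_insert hk]
    exact (hF k (Finset.mem_insert_self k s)).add
      (ih fun j hj => hF j (Finset.mem_insert_of_mem hj))

theorem IsCadlag.restrict {T : ℝ≥0} {f : ℝ≥0 → E} (hf : IsCadlag f) :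
    IsCadlag fun t : Set.Icc (0 : ℝ≥0) T => f t := fun t => by
  obtain ⟨l, hl⟩ := (hf t).2
  refine ⟨(hf t).1.comp continuous_subtype_val.continuousWithinAt fun s hs => hs, l, hl.comp ?_⟩
  exact continuous_subtype_val.continuousWithinAt.tendsto_nhdsWithin fun s hs => hs

theorem IsCadlag.comp_min {f : ℝ≥0 → E} (hf : IsCadlag f) (r : ℝ≥0) :
    IsCadlag fun t => f (min r t) := by
  intro t
  constructor
  · rcases le_or_gt r t with h | h
    · refine (continuousWithinAt_const (b := f r)).congr (fun s hs => ?_) ?_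
      · rw [min_eq_left (h.trans (le_of_lt hs))]
      · simp only [min_eq_left h]
    · refine (hf t).1.congr_of_eventuallyEq ?_ (by rw [min_eq_right h.le])
      filter_upwards [mem_nhdsWithin_of_mem_nhds (Iio_mem_nhds h)] with s hs
      rw [min_eq_right (le_of_lt hs)]
  · rcases lt_or_ge r t with h | h
    · refine ⟨f r, tendsto_const_nhds.congr' ?_⟩
      filter_upwards [mem_nhdsWithin_of_mem_nhds (Ioi_mem_nhds h)] with s hs
      rw [min_eq_left (le_of_lt hs)]
    · obtain ⟨l, hl⟩ := (hf t).2
      refine ⟨l, hl.congr' ?_⟩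
      filter_upwards [self_mem_nhdsWithin] with s hs
      rw [min_eq_right ((le_of_lt hs).trans h)]

/-- Uniform closeness of the paths passes to their left limits, which are therefore Cauchy; limits
in `n` and in time may then be exchanged. -/
theorem IsCadlag.of_tendstoUniformly [CompleteSpace E] {F : ℕ → ι → E}
    (hF : ∀ n, IsCadlag (F n)) (h : TendstoUniformly F f atTop) : IsCadlag f := by
  intro t
  refine ⟨h.tendsto_of_eventually_tendsto (Eventually.of_forall fun n => (hF n t).1)
    (h.tendsto_at t), ?_⟩
  -- If nothing approaches `t` from the left, any value serves as left limit.
  rcases eq_or_neBot (𝓝[<] t) with hbot | hne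
  · exact ⟨0, by rw [hbot]; exact tendsto_bot⟩
  choose L hL using fun n => (hF n t).2
  have hc : CauchySeq L := by
    rw [Metric.cauchySeq_iff]
    intro ε hε
    rw [Metric.tendstoUniformly_iff] at h
    obtain ⟨N, hN⟩ := eventually_atTop.1 (h (ε / 4) (by positivity))
    refine ⟨N, fun m hm n hn => ?_⟩
    have h1 : dist (L m) (L n) ≤ ε / 2 := by
      refine le_of_tendsto ((hL m).dist (hL n)) (Eventually.of_forall fun s => ?_)
      have h2 := hN m hm s
      have h3 := hN n hn s
      have := dist_triangle_left (F m s) (F n s) (f s)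
      linarith
    linarith
  obtain ⟨l, hl⟩ := cauchySeq_tendsto_of_complete hc
  exact ⟨l, h.tendsto_of_eventually_tendsto (Eventually.of_forall hL) hl⟩

/-- A sequence of càdlàg paths whose increments are eventually dominated by a geometric sequence
has a càdlàg limit. -/
theorem IsCadlag.exists_limit [CompleteSpace E] {F : ℕ → ι → E} (hF : ∀ n, IsCadlag (F n))
    (h : ∀ᶠ n in atTop, ∀ t, ‖F (n + 1) t - F n t‖ ≤ (1 / 2) ^ n) :
    ∃ g : ι → E, IsCadlag g ∧ ∀ t, Tendsto (fun n => F n t) atTop (𝓝 (g t)) := by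
  obtain ⟨N, hN⟩ := eventually_atTop.1 h
  have hd : ∀ t n, dist (F (n + N) t) (F (n + 1 + N) t) ≤ 1 * (1 / 2) ^ n := by
    intro t n
    rw [dist_comm, dist_eq_norm, one_mul, add_right_comm]
    refine (hN (n + N) (Nat.le_add_left _ _) t).trans ?_
    exact pow_le_pow_of_le_one (by norm_num) (by norm_num) (Nat.le_add_right _ _)
  have hlim : ∀ t, ∃ l, Tendsto (fun n => F (n + N) t) atTop (𝓝 l) := fun t =>
    cauchySeq_tendsto_of_complete (cauchySeq_of_le_geometric _ _ (by norm_num) (hd t))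
  choose g hg using hlim
  refine ⟨g, IsCadlag.of_tendstoUniformly (F := fun n => F (n + N)) (fun n => hF _) ?_,
    fun t => (tendsto_add_atTop_iff_nat N).1 (hg t)⟩
  rw [Metric.tendstoUniformly_iff]
  intro ε hε
  have h0 : Tendsto (fun n : ℕ => (1 : ℝ) * (1 / 2) ^ n / (1 - 1 / 2)) atTop (𝓝 0) := by
    have := (tendsto_pow_atTop_nhds_zero_of_lt_one (r := (1 / 2 : ℝ)) (by norm_num)
      (by norm_num)).const_mul 1 |>.div_const (1 - 1 / 2)
    simpa using this
  filter_upwards [h0.eventually (gt_mem_nhds hε)] with n hn t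
  rw [dist_comm]
  exact (dist_le_of_le_geometric_of_tendsto _ _ (by norm_num) (hd t) (hg t) n).trans_lt hn

end Cadlag

/-! ### Doob's maximal inequality for step integrals -/

variable {Ω : Type*} {mΩ : MeasurableSpace Ω} {𝓕 : Filtration ℝ≥0 mΩ} {P : Measure Ω}
  [IsProbabilityMeasure P] {M : ℝ≥0 → Ω → ℝ}
  {H : Type*} [NormedAddCommGroup H] [InnerProductSpace ℝ H]

namespace IsSquareIntegrableLevy

theorem ae_isCadlag_stepIntegral (h : IsSquareIntegrableLevy 𝓕 P M) (x : Atom 𝓕 P H →₀ ℝ) :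
    ∀ᵐ ω ∂P, IsCadlag fun t => stepIntegral M t x ω := by
  filter_upwards [h.cadlag] with ω hω
  simp_rw [stepIntegral_apply, Atom.integral]
  exact isCadlag_finsetSum _ fun a _ =>
    (((hω.comp_min a.right).sub (hω.comp_min a.left)).smul_const (a.val ω)).const_smul (x a)

/-- In the expansion of `‖N t‖²` around `N s`, for the step integral `N`, the cross term vanishes on
`B`, because the increment is orthogonal to `1_B N s`. Thus `‖N‖²` is a submartingale. -/
theorem setIntegral_norm_sq_stepIntegral_le (h : IsSquareIntegrableLevy 𝓕 P M)
    (hM : Martingale M 𝓕 P) (x : Atom 𝓕 P H →₀ ℝ) {s t : ℝ≥0} (hst : s ≤ t) {B : Set Ω}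
    (hB : MeasurableSet[𝓕 s] B) :
    ∫ ω in B, ‖stepIntegral M s x ω‖ ^ 2 ∂P ≤ ∫ ω in B, ‖stepIntegral M t x ω‖ ^ 2 ∂P := by
  have hI := h.isL2Integrator (H := H) hM t
  have hs := hI.memLp_stepIntegral x s
  have ht := hI.memLp_stepIntegral x t
  have hB' : MeasurableSet B := 𝓕.le s B hB
  have hts : MemLp (fun ω => stepIntegral M t x ω - stepIntegral M s x ω) 2 P := ht.sub hs
  have h0 := h.integral_inner_stepIntegral_sub hM hst x
    ((hI.stronglyMeasurable_stepIntegral x s).indicator hB) (hs.indicator hB')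
  have h1 : ∀ ω, inner ℝ (stepIntegral M t x ω - stepIntegral M s x ω)
      (B.indicator (stepIntegral M s x) ω) = B.indicator (fun ω => inner ℝ
        (stepIntegral M t x ω - stepIntegral M s x ω) (stepIntegral M s x ω)) ω := by
    intro ω
    by_cases hω : ω ∈ B <;> simp [hω]
  simp_rw [h1] at h0
  rw [integral_indicator hB'] at h0
  have hi := (integrable_inner_of_memLp hts hs).integrableOn (s := B)
  have hsq := ((memLp_two_iff_integrable_sq_norm hs.1).1 hs).integrableOn (s := B)
  calc ∫ ω in B, ‖stepIntegral M s x ω‖ ^ 2 ∂P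
      = ∫ ω in B, (‖stepIntegral M s x ω‖ ^ 2 + 2 * inner ℝ
        (stepIntegral M t x ω - stepIntegral M s x ω) (stepIntegral M s x ω)) ∂P := by
        rw [integral_add hsq (hi.const_mul 2), integral_const_mul, h0, mul_zero, add_zero]
    _ ≤ ∫ ω in B, ‖stepIntegral M t x ω‖ ^ 2 ∂P := by
        refine integral_mono (hsq.add (hi.const_mul 2))
          (((memLp_two_iff_integrable_sq_norm ht.1).1 ht).integrableOn) fun ω => ?_
        have h2 : stepIntegral M t x ω = (stepIntegral M t x ω - stepIntegral M s x ω)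
          + stepIntegral M s x ω := by simp
        have h3 := norm_add_sq_real (stepIntegral M t x ω - stepIntegral M s x ω)
          (stepIntegral M s x ω)
        rw [← h2] at h3
        beta_reduce
        rw [h3]
        nlinarith [sq_nonneg ‖stepIntegral M t x ω - stepIntegral M s x ω‖]

/-- Doob's maximal inequality along an increasing sequence of times. -/
theorem measure_exists_le_norm_stepIntegral (h : IsSquareIntegrableLevy 𝓕 P M)
    (hM : Martingale M 𝓕 P) (x : Atom 𝓕 P H →₀ ℝ) {s : ℕ → ℝ≥0} (hs : Monotone s) (n : ℕ)
    (c : ℝ≥0) :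
    (c : ℝ≥0∞) ^ 2 * P {ω | ∃ k ≤ n, (c : ℝ) ≤ ‖stepIntegral M (s k) x ω‖}
      ≤ eLpNorm (stepIntegral M (s n) x) 2 P ^ 2 := by
  let 𝒢 : Filtration ℕ mΩ :=
    ⟨fun k => 𝓕 (s k), fun i j hij => 𝓕.mono (hs hij), fun k => 𝓕.le _⟩
  have hmem : ∀ t, MemLp (stepIntegral M t x) 2 P := fun t =>
    (h.isL2Integrator (H := H) hM t).memLp_stepIntegral x t
  have hint : ∀ t, Integrable (fun ω => ‖stepIntegral M t x ω‖ ^ 2) P := fun t =>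
    (memLp_two_iff_integrable_sq_norm (hmem t).1).1 (hmem t)
  have hsub : Submartingale (fun k ω => ‖stepIntegral M (s k) x ω‖ ^ 2) 𝒢 P := by
    refine submartingale_of_setIntegral_le_succ (fun k => ?_) (fun k => hint (s k))
      fun k B hB => h.setIntegral_norm_sq_stepIntegral_le hM x (hs k.le_succ) hB
    exact ((h.isL2Integrator (H := H) hM (s k)).stronglyMeasurable_stepIntegral x (s k)).norm.pow 2
  have h1 := maximal_ineq hsub (fun k ω => by positivity) (ε := c ^ 2) n
  have h2 : {ω | ∃ k ≤ n, (c : ℝ) ≤ ‖stepIntegral M (s k) x ω‖}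
      ⊆ {ω | ((c ^ 2 : ℝ≥0) : ℝ) ≤ (Finset.range (n + 1)).sup' Finset.nonempty_range_add_one
        fun k => ‖stepIntegral M (s k) x ω‖ ^ 2} := by
    rintro ω ⟨k, hk, hck⟩
    rw [Set.mem_ofPred_eq, Finset.le_sup'_iff]
    refine ⟨k, Finset.mem_range.2 (Nat.lt_succ_of_le hk), ?_⟩
    push_cast
    gcongr
  rw [eLpNorm_two_sq_eq_integral (hmem (s n))]
  calc _ ≤ _ := by
        rw [← ENNReal.coe_pow]
        exact mul_le_mul_right (measure_mono h2) _
    _ ≤ _ := h1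
    _ ≤ _ := ENNReal.ofReal_le_ofReal (setIntegral_le_integral (hint (s n))
        (ae_of_all _ fun ω => by positivity))

/-- Doob's maximal inequality for integrals of step processes. -/
theorem measure_exists_lt_norm_stepIntegral (h : IsSquareIntegrableLevy 𝓕 P M)
    (hM : Martingale M 𝓕 P) (x : Atom 𝓕 P H →₀ ℝ) (T c : ℝ≥0) :
    (c : ℝ≥0∞) ^ 2 * P {ω | ∃ t ≤ T, (c : ℝ) < ‖stepIntegral M t x ω‖}
      ≤ eLpNorm (stepIntegral M T x) 2 P ^ 2 := by
  -- Dyadic times: refining the grid enlarges the events `D m`, so the discrete inequality passes to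
  -- their union.
  let s : ℕ → ℕ → ℝ≥0 := fun m k => T * k / 2 ^ m
  have hs : ∀ m, Monotone (s m) := fun m i j hij => by
    simp only [s]; gcongr
  have hsT : ∀ m, s m (2 ^ m) = T := fun m => by
    simp [s]
  let D : ℕ → Set Ω := fun m => {ω | ∃ k ≤ 2 ^ m, (c : ℝ) ≤ ‖stepIntegral M (s m k) x ω‖}
  have hD : Monotone D := by
    refine monotone_nat_of_le_succ fun m => ?_
    rintro ω ⟨k, hk, hck⟩
    refine ⟨2 * k, by rw [pow_succ, mul_comm]; gcongr, ?_⟩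
    have : s (m + 1) (2 * k) = s m k := by
      simp only [s]
      push_cast
      rw [pow_succ, mul_left_comm, mul_comm (2 ^ m) (2 : ℝ≥0)]
      exact mul_div_mul_left _ _ two_ne_zero
    rwa [this]
  have hsub : ∀ᵐ ω ∂P, ω ∈ {ω | ∃ t ≤ T, (c : ℝ) < ‖stepIntegral M t x ω‖} → ω ∈ ⋃ m, D m := by
    filter_upwards [h.ae_isCadlag_stepIntegral x] with ω hω
    rintro ⟨t, htT, hct⟩
    rcases htT.eq_or_lt with rfl | htT
    · exact Set.mem_iUnion.2 ⟨0, 2 ^ 0, le_rfl, by rw [hsT]; exact hct.le⟩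
    have hT : 0 < T := lt_of_le_of_lt zero_le htT
    -- The first grid time strictly after `t`. It is within `T 2⁻ᵐ` of `t` and at most `T` because
    -- `t < T`; right-continuity carries the strict inequality at `t` over to it.
    let k : ℕ → ℕ := fun m => ⌊t / T * 2 ^ m⌋₊ + 1
    have hk1 : ∀ m, t < s m (k m) := by
      intro m
      have h1 : t / T * 2 ^ m < k m := by
        simpa [k] using Nat.lt_floor_add_one (t / T * 2 ^ m)
      simp only [s]
      rw [lt_div_iff₀ (by positivity)]
      calc t * 2 ^ m = T * (t / T * 2 ^ m) := by field_simp
        _ < T * k m := by gcongr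
    have hk2 : ∀ m, s m (k m) ≤ t + T * (1 / 2) ^ m := by
      intro m
      have h1 : (k m : ℝ≥0) ≤ t / T * 2 ^ m + 1 := by
        simp only [k]
        push_cast
        gcongr
        exact Nat.floor_le zero_le
      simp only [s]
      calc T * (k m : ℝ≥0) / 2 ^ m ≤ T * (t / T * 2 ^ m + 1) / 2 ^ m := by gcongr
        _ = t + T * (1 / 2) ^ m := by
          rw [one_div, inv_pow]
          field_simp
    have hk3 : ∀ m, k m ≤ 2 ^ m := by
      intro m
      have : ⌊t / T * 2 ^ m⌋₊ < 2 ^ m := by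
        rw [Nat.floor_lt zero_le]
        push_cast
        have : t / T < 1 := (div_lt_one hT).2 htT
        calc t / T * 2 ^ m < 1 * 2 ^ m := by gcongr
          _ = 2 ^ m := one_mul _
      exact this
    have hlim : Tendsto (fun m => s m (k m)) atTop (𝓝[>] t) := by
      refine tendsto_nhdsWithin_iff.2 ⟨?_, Eventually.of_forall hk1⟩
      refine tendsto_of_tendsto_of_tendsto_of_le_of_le tendsto_const_nhds ?_
        (fun m => (hk1 m).le) hk2
      have h0 : Tendsto (fun m : ℕ => (1 / 2 : ℝ≥0) ^ m) atTop (𝓝 0) :=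
        NNReal.tendsto_pow_atTop_nhds_zero_of_lt_one (by
          rw [← NNReal.coe_lt_coe]; norm_num)
      simpa using (h0.const_mul T).const_add t
    have hN := ((hω t).1.tendsto.comp hlim).norm
    obtain ⟨m, hm⟩ := (hN.eventually (lt_mem_nhds hct)).exists
    exact Set.mem_iUnion.2 ⟨m, k m, hk3 m, le_of_lt hm⟩
  calc (c : ℝ≥0∞) ^ 2 * P {ω | ∃ t ≤ T, (c : ℝ) < ‖stepIntegral M t x ω‖}
      ≤ (c : ℝ≥0∞) ^ 2 * P (⋃ m, D m) := by
        gcongr 1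
        exact measure_mono_ae hsub
    _ = ⨆ m, (c : ℝ≥0∞) ^ 2 * P (D m) := by
        rw [hD.directed_le.measure_iUnion, ENNReal.mul_iSup]
    _ ≤ eLpNorm (stepIntegral M T x) 2 P ^ 2 := by
        refine iSup_le fun m => ?_
        have := h.measure_exists_le_norm_stepIntegral hM x (hs m) (2 ^ m) c
        rwa [hsT] at this

end IsSquareIntegrableLevy

end LevyCurve

/-! ### Construction and identification of the Itô integral -/

namespace LevyCurve

/-- The primitive of an integrable path is continuous. -/
theorem continuous_setIntegral_Icc {H : Type*} [NormedAddCommGroup H] [NormedSpace ℝ H] {T : ℝ≥0}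
    {f : ℝ≥0 → H} (hf : IntegrableOn f (Set.Icc 0 T) lebesgue) :
    Continuous fun t : Set.Icc (0 : ℝ≥0) T => ∫ s in Set.Icc (0 : ℝ≥0) t, f s ∂lebesgue := by
  have h1 : ∀ t : Set.Icc (0 : ℝ≥0) T, ∫ s in Set.Icc (0 : ℝ≥0) t, f s ∂lebesgue
      = ∫ s, (Set.Iic (t : ℝ≥0)).indicator f s ∂lebesgueTo T := by
    intro t
    rw [integral_indicator measurableSet_Iic, Measure.restrict_restrict measurableSet_Iic]
    congr 2
    ext s
    simp only [Set.mem_Icc, Set.mem_inter_iff, Set.mem_Iic, zero_le, true_and]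
    exact ⟨fun h => ⟨h, h.trans t.2.2⟩, fun h => h.1⟩
  simp_rw [h1]
  rw [continuous_iff_continuousAt]
  intro t
  refine continuousAt_of_dominated (bound := fun s => ‖f s‖)
    (Eventually.of_forall fun r => hf.1.indicator measurableSet_Iic)
    (Eventually.of_forall fun r => ae_of_all _ fun s => norm_indicator_le_norm_self f s) hf.norm ?_
  have hval : Tendsto (fun r : Set.Icc (0 : ℝ≥0) T => (r : ℝ≥0)) (𝓝 t) (𝓝 (t : ℝ≥0)) :=
    continuous_subtype_val.tendsto t
  -- For `s ≠ t` the indicator of `[0,r]` at `s` is constant for `r` near `t`; the time `s = t` is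
  -- null.
  filter_upwards [ae_lebesgueTo_ne T t] with s hs
  rcases lt_or_gt_of_ne hs with h | h
  · refine (continuousAt_const (y := f s)).congr ?_
    filter_upwards [hval.eventually (Ioi_mem_nhds h)] with r hr
    exact (Set.indicator_of_mem (show s ∈ Set.Iic (r : ℝ≥0) from le_of_lt hr) f).symm
  · refine (continuousAt_const (y := (0 : H))).congr ?_
    filter_upwards [hval.eventually (Iio_mem_nhds h)] with r hr
    exact (Set.indicator_of_notMem (show s ∉ Set.Iic (r : ℝ≥0) from not_le.2 hr) f).symm

theorem one_quarter_lt_one : (1 / 4 : ℝ≥0) < 1 := by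
  rw [← NNReal.coe_lt_coe]
  norm_num

theorem summable_one_quarter_pow : Summable fun k : ℕ => (1 / 4 : ℝ≥0) ^ k := by
  rw [← NNReal.summable_coe]
  push_cast
  exact summable_geometric_of_lt_one (by norm_num) (by norm_num)

variable {Ω : Type*} {mΩ : MeasurableSpace Ω} {𝓕 : Filtration ℝ≥0 mΩ} {P : Measure Ω}
  [IsProbabilityMeasure P] {M : ℝ≥0 → Ω → ℝ}
  {H : Type*} [NormedAddCommGroup H] [InnerProductSpace ℝ H]

/-- If step processes converge fast in mean square, then their integrals almost surely have a
càdlàg limit. -/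
theorem IsSquareIntegrableLevy.ae_exists_cadlag_limit [CompleteSpace H]
    (h : IsSquareIntegrableLevy 𝓕 P M)
    (hM : Martingale M 𝓕 P) {T : ℝ≥0} {Φp : ℝ≥0 × Ω → H}
    (hm : AEStronglyMeasurable Φp ((lebesgueTo T).prod P)) {x : ℕ → Atom 𝓕 P H →₀ ℝ}
    (hx : ∀ k, eLpNorm (fun p => stepEval (x k) p - Φp p) 2 ((lebesgueTo T).prod P)
      ≤ (((1 / 4) ^ k : ℝ≥0) : ℝ≥0∞)) :
    ∀ᵐ ω ∂P, ∃ g : Set.Icc (0 : ℝ≥0) T → H, IsCadlag g ∧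
      ∀ t : Set.Icc (0 : ℝ≥0) T, Tendsto (fun k => stepIntegral M t (x k) ω) atTop (𝓝 (g t)) := by
  set C : ℝ≥0 := NNReal.sqrt (Var[M 1; P]).toNNReal
  have hI : IsL2Integrator 𝓕 P H M T C := h.isL2Integrator hM T
  -- Consecutive integrands differ by at most `2 · 4⁻ᵏ` in L², so Doob with threshold `2⁻ᵏ` gives
  -- `4⁻ᵏ P ≤ 4 C² 16⁻ᵏ`. The resulting bounds are summable, and Borel–Cantelli applies.
  have hP : ∀ k, P {ω | ∃ t ≤ T, (((1 / 2) ^ k : ℝ≥0) : ℝ)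
      < ‖stepIntegral M t (x (k + 1) - x k) ω‖} ≤ ((4 * C ^ 2 * (1 / 4) ^ k : ℝ≥0) : ℝ≥0∞) := by
    intro k
    have h1 := h.measure_exists_lt_norm_stepIntegral hM (x (k + 1) - x k) T ((1 / 2) ^ k)
    have h2 := hI.bound T le_rfl (x (k + 1) - x k)
    have h3 : eLpNorm (stepEval (x (k + 1) - x k)) 2 ((lebesgueTo T).prod P)
        ≤ ((2 * (1 / 4) ^ k : ℝ≥0) : ℝ≥0∞) := by
      have h4 : stepEval (x (k + 1) - x k)
          = (fun p => stepEval (x (k + 1)) p - Φp p) - fun p => stepEval (x k) p - Φp p := by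
        ext p; simp
      rw [h4]
      refine (eLpNorm_sub_le ((memLp_stepEval _ _).1.sub hm) ((memLp_stepEval _ _).1.sub hm)
        one_le_two).trans ((add_le_add (hx _) (hx _)).trans ?_)
      rw [← ENNReal.coe_add, ENNReal.coe_le_coe, two_mul]
      exact add_le_add (pow_le_pow_of_le_one zero_le one_quarter_lt_one.le k.le_succ) le_rfl
    have h5 : (((1 / 2) ^ k : ℝ≥0) : ℝ≥0∞) ^ 2 * P {ω | ∃ t ≤ T, (((1 / 2) ^ k : ℝ≥0) : ℝ)
        < ‖stepIntegral M t (x (k + 1) - x k) ω‖}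
        ≤ (((1 / 2) ^ k : ℝ≥0) : ℝ≥0∞) ^ 2 * ((4 * C ^ 2 * (1 / 4) ^ k : ℝ≥0) : ℝ≥0∞) := by
      refine h1.trans ((pow_le_pow_left' (h2.trans (mul_le_mul_right h3 _)) 2).trans (le_of_eq ?_))
      rw [← ENNReal.coe_mul, ← ENNReal.coe_pow, ← ENNReal.coe_pow, ← ENNReal.coe_mul,
        ENNReal.coe_inj]
      have h6 : ((1 / 2 : ℝ≥0) ^ k) ^ 2 = (1 / 4) ^ k := by
        rw [← pow_mul, mul_comm, pow_mul]
        congr 1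
        rw [← NNReal.coe_inj]
        norm_num
      rw [h6]
      ring
    refine (ENNReal.mul_le_mul_iff_right ?_ ?_).1 h5
    · exact pow_ne_zero 2 (ENNReal.coe_ne_zero.2 (by positivity))
    · exact ENNReal.pow_ne_top ENNReal.coe_ne_top
  have hsum : ∑' k, P {ω | ∃ t ≤ T, (((1 / 2) ^ k : ℝ≥0) : ℝ)
      < ‖stepIntegral M t (x (k + 1) - x k) ω‖} ≠ ∞ := by
    refine ne_top_of_le_ne_top ?_ (ENNReal.tsum_le_tsum hP)
    rw [ENNReal.tsum_coe_ne_top_iff_summable]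
    exact summable_one_quarter_pow.mul_left _
  filter_upwards [ae_eventually_notMem hsum,
    ae_all_iff.2 fun k => h.ae_isCadlag_stepIntegral (x k)] with ω h1 h2
  refine IsCadlag.exists_limit (F := fun k (t : Set.Icc (0 : ℝ≥0) T) => stepIntegral M t (x k) ω)
    (fun k => (h2 k).restrict) (h1.mono fun k hk t => ?_)
  by_contra hc
  refine hk ⟨t, t.2.2, ?_⟩
  rw [not_le] at hc
  simpa using hc

variable [CompleteSpace H] [SecondCountableTopology H] {T : ℝ≥0} {Φ : Cad 𝓕 P H T}
  {Φp : ℝ≥0 → Ω → H} {A : ℝ≥0 → Ω → ℝ} {C : ℝ≥0} {G : Set.Icc (0 : ℝ≥0) T → Lp H 2 P}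

theorem ExtendsStepIntegral.eLpNorm_le
    (hG : ExtendsStepIntegral 𝓕 A C (Function.uncurry Φp) G) (t : Set.Icc (0 : ℝ≥0) T)
    (x : Atom 𝓕 P H →₀ ℝ) : eLpNorm (fun ω => stepIntegral A t x ω - G t ω) 2 P
      ≤ C * eLpNorm (fun p => stepEval x p - Function.uncurry Φp p) 2 ((lebesgueTo T).prod P) :=
  (hG t x).trans (mul_le_mul_right (eLpNorm_lebesgueTo_mono t.2.2 _) _)

theorem IsPredictableVersion.exists_step (h𝓕 : UsualConditions 𝓕 P)
    (hΦp : IsPredictableVersion Φ Φp) (ε : ℝ≥0∞) (hε : ε ≠ 0) : ∃ x : Atom 𝓕 P H →₀ ℝ,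
      eLpNorm (fun p => stepEval x p - Function.uncurry Φp p) 2 ((lebesgueTo T).prod P) ≤ ε :=
  let ⟨Ψ, hΨ⟩ := hΦp.exists_elementary h𝓕 hε
  ⟨Ψ.toStep P, hΨ⟩

/-- Every approximating sequence yields the same limit `G t`, so the Itô integral does not depend on
the sequence that witnesses it. -/
theorem ExtendsStepIntegral.tendsto_elementary
    (hG : ExtendsStepIntegral 𝓕 A C (Function.uncurry Φp) G) {Ψ : ℕ → ElementaryProcess 𝓕 H}
    (hΨ : Tendsto (fun k => eLpNorm (fun p : ℝ≥0 × Ω => (Ψ k).eval p.1 p.2 - Φp p.1 p.2) 2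
      ((lebesgueTo T).prod P)) atTop (𝓝 0)) (t : Set.Icc (0 : ℝ≥0) T) :
    Tendsto (fun k => eLpNorm (fun ω => (Ψ k).integral A t ω - G t ω) 2 P) atTop (𝓝 0) := by
  have h1 := ENNReal.Tendsto.const_mul (a := (C : ℝ≥0∞)) hΨ (Or.inr ENNReal.coe_ne_top)
  rw [mul_zero] at h1
  refine tendsto_of_tendsto_of_tendsto_of_le_of_le tendsto_const_nhds h1 (fun _ => zero_le)
    fun k => ?_
  have h2 := hG.eLpNorm_le t ((Ψ k).toStep P)
  simp_rw [ElementaryProcess.stepIntegral_toStep, ElementaryProcess.stepEval_toStep] at h2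
  exact h2

theorem exists_isItoIntegral (h : IsSquareIntegrableLevy 𝓕 P M) (hM : Martingale M 𝓕 P)
    (h𝓕 : UsualConditions 𝓕 P) (hΦp : IsPredictableVersion Φ Φp)
    (hI : IsL2Integrator 𝓕 P H M T C)
    (hG : ExtendsStepIntegral 𝓕 M C (Function.uncurry Φp) G) :
    ∃ N : Set.Icc (0 : ℝ≥0) T → Ω → H, IsItoIntegral 𝓕 P M Φp N ∧ ∀ t, N t =ᵐ[P] G t := by
  classical
  have hε : ∀ k : ℕ, (((1 / 4) ^ k : ℝ≥0) : ℝ≥0∞) ≠ 0 := fun k =>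
    ENNReal.coe_ne_zero.2 (by positivity)
  choose Ψ hΨ using fun k => hΦp.exists_elementary h𝓕 (hε k)
  have hΨ0 : Tendsto (fun k => eLpNorm (fun p : ℝ≥0 × Ω => (Ψ k).eval p.1 p.2 - Φp p.1 p.2) 2
      ((lebesgueTo T).prod P)) atTop (𝓝 0) := by
    have h0 : Tendsto (fun k : ℕ => (((1 / 4) ^ k : ℝ≥0) : ℝ≥0∞)) atTop (𝓝 0) :=
      ENNReal.tendsto_coe.2 (NNReal.tendsto_pow_atTop_nhds_zero_of_lt_one one_quarter_lt_one)
    refine tendsto_of_tendsto_of_tendsto_of_le_of_le tendsto_const_nhds h0 (fun _ => zero_le)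
      fun k => ?_
    have := hΨ k
    simp_rw [ElementaryProcess.stepEval_toStep] at this
    exact this
  have hlim := h.ae_exists_cadlag_limit hM hΦp.stronglyMeasurable.aestronglyMeasurable hΨ
  -- The limit path is chosen separately for each `ω`, and is `0` on the exceptional null set so
  -- that all paths are càdlàg. Measurability is recovered from almost sure equality with `G t` and
  -- completeness.
  let N : Set.Icc (0 : ℝ≥0) T → Ω → H := fun t ω =>
    if hω : ∃ g : Set.Icc (0 : ℝ≥0) T → H, IsCadlag g ∧
      ∀ t : Set.Icc (0 : ℝ≥0) T, Tendsto (fun k => stepIntegral M t ((Ψ k).toStep P) ω) atTop (𝓝 (g t))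
    then hω.choose t else 0
  have hNG : ∀ t, N t =ᵐ[P] G t := by
    intro t
    have hsum : ∑' k, ∫⁻ ω, ‖stepIntegral M t ((Ψ k).toStep P) ω - (G t : Ω → H) ω‖ₑ ^ 2 ∂P
        ≠ ∞ := by
      have hb : ∀ k, ∫⁻ ω, ‖stepIntegral M t ((Ψ k).toStep P) ω - (G t : Ω → H) ω‖ₑ ^ 2 ∂P
          ≤ ((C ^ 2 * (1 / 4) ^ k : ℝ≥0) : ℝ≥0∞) := by
        intro k
        rw [← eLpNorm_two_sq]
        calc _ ≤ ((C : ℝ≥0∞) * (((1 / 4) ^ k : ℝ≥0) : ℝ≥0∞)) ^ 2 := by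
              gcongr
              exact (hG.eLpNorm_le t _).trans (mul_le_mul_right (hΨ k) _)
          _ ≤ _ := by
              rw [← ENNReal.coe_mul, ← ENNReal.coe_pow, ENNReal.coe_le_coe, mul_pow]
              exact mul_le_mul_right (pow_le_of_le_one zero_le
                (pow_le_one₀ zero_le one_quarter_lt_one.le) two_ne_zero) _
      refine ne_top_of_le_ne_top ?_ (ENNReal.tsum_le_tsum hb)
      rw [ENNReal.tsum_coe_ne_top_iff_summable]
      exact summable_one_quarter_pow.mul_left _
    filter_upwards [hlim, ae_tendsto_of_tsum_lintegral
      (fun k => (hI.memLp_stepIntegral ((Ψ k).toStep P) t).1)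
      (Lp.aestronglyMeasurable (G t)) hsum] with ω h1 h2
    have h3 : N t ω = h1.choose t := dif_pos h1
    rw [h3]
    exact tendsto_nhds_unique (h1.choose_spec.2 t) h2
  refine ⟨N, ⟨hΦp.isL2Predictable, fun t => ?_, fun ω => ?_, Ψ, ?_, fun t => ?_⟩, hNG⟩
  · exact h𝓕.stronglyMeasurable_of_mem_lpMeas (hG.mem_lpMeas hI (hΦp.exists_step h𝓕) t) (hNG t)
  · by_cases hω : ∃ g : Set.Icc (0 : ℝ≥0) T → H, IsCadlag g ∧
      ∀ t : Set.Icc (0 : ℝ≥0) T, Tendsto (fun k => stepIntegral M t ((Ψ k).toStep P) ω) atTop (𝓝 (g t))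
    · have : (fun t => N t ω) = hω.choose := funext fun t => dif_pos hω
      rw [this]
      exact hω.choose_spec.1
    · have : (fun t => N t ω) = fun _ => 0 := funext fun t => dif_neg hω
      rw [this]
      exact isCadlag_const 0
  · exact hΨ0
  · refine (hG.tendsto_elementary hΨ0 t).congr fun k => eLpNorm_congr_ae ?_
    filter_upwards [hNG t] with ω hω
    rw [hω]

theorem IsItoIntegral.ae_eq (hI : IsL2Integrator 𝓕 P H M T C)
    (hG : ExtendsStepIntegral 𝓕 M C (Function.uncurry Φp) G)
    {N : Set.Icc (0 : ℝ≥0) T → Ω → H} (hN : IsItoIntegral 𝓕 P M Φp N)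
    (t : Set.Icc (0 : ℝ≥0) T) : N t =ᵐ[P] G t := by
  obtain ⟨Ψ, hΨ, hΨN⟩ := hN.limit
  refine ae_eq_of_tendsto_eLpNorm (f := fun k => (Ψ k).integral M t) (fun k => ?_)
    ((hN.adapted t).mono (𝓕.le _)).aestronglyMeasurable (Lp.aestronglyMeasurable _) (hΨN t)
    (hG.tendsto_elementary hΨ t)
  have : (Ψ k).integral M t = stepIntegral M t ((Ψ k).toStep P) :=
    funext fun ω => ((Ψ k).stepIntegral_toStep M t ω).symm
  rw [this]
  exact (hI.memLp_stepIntegral _ _).1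

theorem gIntegral_eq (hA : ∀ s, AEStronglyMeasurable (A s) P) {t : Set.Icc (0 : ℝ≥0) T}
    {Y : Lp H 2 P} (hY : IsGIntegralAt A Φ t Y) : gIntegral A Φ t = Y :=
  IsGIntegralAt.unique hA (Classical.epsilon_spec (p := IsGIntegralAt A Φ t) ⟨Y, hY⟩) hY

theorem exists_isItoIntegralLevy (h𝓕 : UsualConditions 𝓕 P) {b : ℝ}
    (hΦp : IsPredictableVersion Φ Φp) {N : Set.Icc (0 : ℝ≥0) T → Ω → H}
    (hN : IsItoIntegral 𝓕 P M Φp N) {I : Set.Icc (0 : ℝ≥0) T → Lp H 2 P}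
    (hI : ∀ t : Set.Icc (0 : ℝ≥0) T, I t ∈ lpMeas H ℝ (𝓕 t) 2 P)
    (hNI : ∀ t : Set.Icc (0 : ℝ≥0) T,
      (fun ω => N t ω + b • ∫ s in Set.Icc (0 : ℝ≥0) t, Φp s ω ∂lebesgue) =ᵐ[P] I t) :
    ∃ Z : Set.Icc (0 : ℝ≥0) T → Ω → H, IsItoIntegralLevy 𝓕 P M b Φp Z ∧
      ∀ t, Z t =ᵐ[P] I t := by
  classical
  have hint : ∀ᵐ ω ∂P, IntegrableOn (fun s : ℝ≥0 => Φp s ω) (Set.Icc 0 T) lebesgue :=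
    ae_integrable_section hΦp.isL2Predictable.memLp
  -- A path not integrable on `[0,T]` may be integrable on shorter intervals, and its primitive
  -- could behave badly when the integral takes its default value; on such `ω` the drift term is set
  -- to `0`.
  let Z : Set.Icc (0 : ℝ≥0) T → Ω → H := fun t ω =>
    N t ω + if IntegrableOn (fun s : ℝ≥0 => Φp s ω) (Set.Icc 0 T) lebesgue then
      b • ∫ s in Set.Icc (0 : ℝ≥0) t, Φp s ω ∂lebesgue else 0
  have hZ : ∀ᵐ ω ∂P, ∀ t : Set.Icc (0 : ℝ≥0) T,
      Z t ω = N t ω + b • ∫ s in Set.Icc (0 : ℝ≥0) t, Φp s ω ∂lebesgue := by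
    filter_upwards [hint] with ω hω t
    simp only [Z]
    rw [if_pos hω]
  have hZI : ∀ t, Z t =ᵐ[P] I t := by
    intro t
    filter_upwards [hZ, hNI t] with ω h1 h2
    rw [h1, h2]
  refine ⟨Z, ⟨fun t => h𝓕.stronglyMeasurable_of_mem_lpMeas (hI t) (hZI t), fun ω => ?_, hint, N, hN,
    hZ⟩, hZI⟩
  refine (hN.cadlag ω).add ?_
  by_cases hω : IntegrableOn (fun s : ℝ≥0 => Φp s ω) (Set.Icc 0 T) lebesgue
  · simp only [if_pos hω]
    exact isCadlag_of_continuous ((continuous_setIntegral_Icc hω).const_smul b)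
  · simp only [if_neg hω]
    exact isCadlag_const 0

end LevyCurve

/-! ### Assembly of the main theorem -/

theorem mainTheorem2 {Ω : Type*} {mΩ : MeasurableSpace Ω} (P : Measure Ω) [IsProbabilityMeasure P]
    (𝓕 : Filtration ℝ≥0 mΩ) (h𝓕 : LevyCurve.UsualConditions 𝓕 P)
    (H : Type*) [NormedAddCommGroup H] [InnerProductSpace ℝ H] [CompleteSpace H]
    [TopologicalSpace.SeparableSpace H]
    (X : ℝ≥0 → Ω → ℝ) (hX : LevyCurve.IsSquareIntegrableLevy 𝓕 P X) :
    -- the semimartingale decomposition `X_t = M_t + b t` exists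
    (∃ (M : ℝ≥0 → Ω → ℝ) (b : ℝ), LevyCurve.IsLevyDecomposition 𝓕 P X M b) ∧
    ∀ (M : ℝ≥0 → Ω → ℝ) (b : ℝ), LevyCurve.IsLevyDecomposition 𝓕 P X M b →
    ∀ (T : ℝ≥0) (Φ : LevyCurve.Cad 𝓕 P H T),
      -- the (G-) integrals of `Φ` against `M` and against Lebesgue measure are well defined
      (∀ t, ∃! Y : Lp H 2 P, LevyCurve.IsGIntegralAt M Φ t Y) ∧
      (∀ t, ∃! Y : Lp H 2 P, LevyCurve.IsGIntegralAt LevyCurve.timeIntegrator Φ t Y) ∧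
      -- `(G-)(Φ · X)` is an element `I` of `C_ad[0,T]`
      ∃ I : LevyCurve.Cad 𝓕 P H T,
        (∀ t, I.1 t = LevyCurve.gIntegralLevy M b Φ t) ∧
        -- `Φ` has a predictable version, and any such version lies in `L²(𝒫_T)`, has an Itô
        -- integral against `X`, and this Itô integral is equal to `I` in `C_ad[0,T]`
        (∃ Φp : ℝ≥0 → Ω → H, LevyCurve.IsPredictableVersion Φ Φp) ∧
        (∀ Φp : ℝ≥0 → Ω → H, LevyCurve.IsPredictableVersion Φ Φp →
          LevyCurve.IsL2Predictable 𝓕 P T Φp ∧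
          (∃ Z : Set.Icc (0 : ℝ≥0) T → Ω → H, LevyCurve.IsItoIntegralLevy 𝓕 P M b Φp Z) ∧
          ∀ Z : Set.Icc (0 : ℝ≥0) T → Ω → H, LevyCurve.IsItoIntegralLevy 𝓕 P M b Φp Z →
            ∀ t, Z t =ᵐ[P] (I.1 t : Ω → H)) ∧
        -- `(G-)(Φ · X)` has a càdlàg version
        ∃ Z : Set.Icc (0 : ℝ≥0) T → Ω → H, (∀ ω, LevyCurve.IsCadlag (fun t => Z t ω)) ∧
          ∀ t, Z t =ᵐ[P] (LevyCurve.gIntegralLevy M b Φ t : Ω → H) := by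
  have : SecondCountableTopology H := UniformSpace.secondCountable_of_separable H
  refine ⟨hX.exists_decomposition, fun M b hMb T Φ => ?_⟩
  have hLevy := hMb.levy
  have hMart := hMb.martingale
  have hI := hLevy.isL2Integrator (H := H) hMart T
  have hIt : LevyCurve.IsL2Integrator 𝓕 P H LevyCurve.timeIntegrator T (NNReal.sqrt T) :=
    LevyCurve.isL2Integrator_timeIntegrator T
  have hAM : ∀ s, AEStronglyMeasurable (M s) P := fun s => (hLevy.memLp s).1
  have hAt : ∀ s, AEStronglyMeasurable (LevyCurve.timeIntegrator (Ω := Ω) s) P := fun s =>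
    aestronglyMeasurable_const
  -- The (G-) integrals do not mention a version, yet by uniqueness they extend the step integrals
  -- to every predictable version; this makes the identification uniform over versions.
  have key : ∀ Φp : ℝ≥0 → Ω → H, LevyCurve.IsPredictableVersion Φ Φp →
      LevyCurve.ExtendsStepIntegral 𝓕 M (NNReal.sqrt (Var[M 1; P]).toNNReal) (Function.uncurry Φp)
        (LevyCurve.gIntegral M Φ) ∧ (∀ t, LevyCurve.IsGIntegralAt M Φ t (LevyCurve.gIntegral M Φ t)) ∧
      LevyCurve.ExtendsStepIntegral 𝓕 LevyCurve.timeIntegrator (NNReal.sqrt T) (Function.uncurry Φp)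
        (LevyCurve.gIntegral LevyCurve.timeIntegrator Φ) ∧
      (∀ t, LevyCurve.IsGIntegralAt LevyCurve.timeIntegrator Φ t
        (LevyCurve.gIntegral LevyCurve.timeIntegrator Φ t)) ∧
      ∀ t, LevyCurve.gIntegral LevyCurve.timeIntegrator Φ t
        =ᵐ[P] fun ω => ∫ s in Set.Icc (0 : ℝ≥0) t, Φp s ω ∂LevyCurve.lebesgue := by
    intro Φp hΦp
    obtain ⟨G, hG⟩ := hI.exists_extends hΦp.stronglyMeasurable.aestronglyMeasurable
      (hΦp.exists_step h𝓕)
    obtain ⟨K, hK, hKint⟩ := LevyCurve.extendsStepIntegral_timeIntegrator (𝓕 := 𝓕)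
      hΦp.isL2Predictable.memLp
    have h1 : LevyCurve.gIntegral M Φ = G := funext fun t =>
      LevyCurve.gIntegral_eq hAM (hG.isGIntegralAt h𝓕 hΦp t)
    have h2 : LevyCurve.gIntegral LevyCurve.timeIntegrator Φ = K := funext fun t =>
      LevyCurve.gIntegral_eq hAt (hK.isGIntegralAt h𝓕 hΦp t)
    rw [h1, h2]
    exact ⟨hG, hG.isGIntegralAt h𝓕 hΦp, hK, hK.isGIntegralAt h𝓕 hΦp, hKint⟩
  -- One version suffices for existence, continuity and adaptedness of the (G-) integrals, as these
  -- properties do not involve the version.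
  obtain ⟨Φ₀, hΦ₀⟩ := LevyCurve.exists_isPredictableVersion h𝓕 Φ
  obtain ⟨hG, hGint, hK, hKint, -⟩ := key Φ₀ hΦ₀
  have hcont : Continuous fun t => LevyCurve.gIntegralLevy M b Φ t :=
    (hG.continuous hI (hΦ₀.exists_step h𝓕)).add
      ((hK.continuous hIt (hΦ₀.exists_step h𝓕)).const_smul b)
  have hmem : ∀ t : Set.Icc (0 : ℝ≥0) T, LevyCurve.gIntegralLevy M b Φ t ∈ lpMeas H ℝ (𝓕 t) 2 P :=
    fun t => Submodule.add_mem _ (hG.mem_lpMeas hI (hΦ₀.exists_step h𝓕) t)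
      (Submodule.smul_mem _ b (hK.mem_lpMeas hIt (hΦ₀.exists_step h𝓕) t))
  have hsum : ∀ Φp : ℝ≥0 → Ω → H, LevyCurve.IsPredictableVersion Φ Φp →
      ∀ (t : Set.Icc (0 : ℝ≥0) T) {Y : Ω → H}, Y =ᵐ[P] LevyCurve.gIntegral M Φ t →
      (fun ω => Y ω + b • ∫ s in Set.Icc (0 : ℝ≥0) t, Φp s ω ∂LevyCurve.lebesgue)
        =ᵐ[P] LevyCurve.gIntegralLevy M b Φ t := by
    intro Φp hΦp t Y hY
    obtain ⟨-, -, -, -, hKp⟩ := key Φp hΦp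
    unfold LevyCurve.gIntegralLevy
    filter_upwards [hY, hKp t, Lp.coeFn_add (LevyCurve.gIntegral M Φ t)
      (b • LevyCurve.gIntegral LevyCurve.timeIntegrator Φ t),
      Lp.coeFn_smul b (LevyCurve.gIntegral LevyCurve.timeIntegrator Φ t)] with ω h1 h2 h3 h4
    rw [h3, Pi.add_apply, h4, Pi.smul_apply, h1, h2]
  have hexists : ∀ Φp : ℝ≥0 → Ω → H, LevyCurve.IsPredictableVersion Φ Φp →
      ∃ Z : Set.Icc (0 : ℝ≥0) T → Ω → H, LevyCurve.IsItoIntegralLevy 𝓕 P M b Φp Z ∧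
        ∀ t, Z t =ᵐ[P] LevyCurve.gIntegralLevy M b Φ t := by
    intro Φp hΦp
    obtain ⟨hGp, -⟩ := key Φp hΦp
    obtain ⟨N, hN, hNG⟩ := LevyCurve.exists_isItoIntegral hLevy hMart h𝓕 hΦp hI hGp
    exact LevyCurve.exists_isItoIntegralLevy h𝓕 hΦp hN hmem fun t => hsum Φp hΦp t (hNG t)
  refine ⟨fun t => ⟨_, hGint t, fun Y hY => hY.unique hAM (hGint t)⟩,
    fun t => ⟨_, hKint t, fun Y hY => hY.unique hAt (hKint t)⟩,
    ⟨⟨fun t => LevyCurve.gIntegralLevy M b Φ t, hcont⟩, hmem⟩, fun t => rfl, ⟨Φ₀, hΦ₀⟩,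
    fun Φp hΦp => ⟨hΦp.isL2Predictable, ?_, fun Z hZ t => ?_⟩, ?_⟩
  · obtain ⟨Z, hZ, -⟩ := hexists Φp hΦp
    exact ⟨Z, hZ⟩
  · obtain ⟨N, hN, hZN⟩ := hZ.eq_add
    obtain ⟨hGp, -⟩ := key Φp hΦp
    have h1 := hsum Φp hΦp t (hN.ae_eq hI hGp t)
    filter_upwards [hZN, h1] with ω h2 h3
    rw [h2 t, h3]
    rfl
  · obtain ⟨Z, hZ, hZG⟩ := hexists Φ₀ hΦ₀
    exact ⟨Z, hZ.cadlag, hZG⟩
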